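/- For a finite simple graph $G$ on $n$ vertices let $Q(G)=D(G)+A(G)$ be its signless Laplacian matrix, where $D(G)$ is the diagonal matrix of vertex degrees and $A(G)$ is the adjacency matrix, let $q_1,\dots,q_n$ be the eigenvalues of $Q(G)$ counted with multiplicity, and put $SLEE(G)=\sum_{i=1}^{n}e^{q_i}$. A unicyclic graph is a connected graph with the same number of vertices and edges. Let $n$ and $d$ be integers with $2\le d\le n-2$, and let $a=\lfloor d/2\rfloor$. Let $G^d$ be the $n$-vertex graph obtained from a path $v_0v_1\cdots v_d$ by attaching $n-d-2$ pendant vertices to $v_a$ and adding one further vertex $u$ that is adjacent to exactly $v_a$ and $v_{a+1}$. Then $G^d$ is a unicyclic graph on $n$ vertices with diameter $d$, and every unicyclic graph $G$ on $n$ vertices with diameter $d$ satisfies $SLEE(G)\le SLEE(G^d)$, with equality if and only if $G\cong G^d$. In other words, up to isomorphism, $G^d$ is the unique graph with maximum $SLEE$ among the $n$-vertex unicyclic graphs with diameter $d$. -/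

import Mathlib

/-- The signless Laplacian matrix `Q(G) = D(G) + A(G)`. -/
noncomputable def signlessLaplacian {V : Type*} [Fintype V] [DecidableEq V]
    (G : SimpleGraph V) [DecidableRel G.Adj] : Matrix V V ℝ :=
  G.degMatrix ℝ + G.adjMatrix ℝ

theorem signlessLaplacian_isHermitian {V : Type*} [Fintype V] [DecidableEq V]
    (G : SimpleGraph V) [DecidableRel G.Adj] : (signlessLaplacian G).IsHermitian := by
  unfold signlessLaplacian SimpleGraph.degMatrix
  refine Matrix.IsHermitian.add (Matrix.isHermitian_diagonal _) ?_
  rw [Matrix.IsHermitian, Matrix.conjTranspose_eq_transpose_of_trivial]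
  exact G.transpose_adjMatrix

open Classical in
/-- The signless Laplacian Estrada index: the sum of `exp q` over the eigenvalues `q` of the
signless Laplacian matrix, counted with multiplicity. -/
noncomputable def SLEE {V : Type*} [Fintype V] (G : SimpleGraph V) : ℝ :=
  ∑ i, Real.exp ((signlessLaplacian_isHermitian G).eigenvalues i)

/-- A unicyclic graph: a connected graph with the same number of vertices and edges. -/
def IsUnicyclic {V : Type*} [Fintype V] (G : SimpleGraph V) : Prop :=
  G.Connected ∧ G.edgeSet.ncard = Fintype.card V

/-- The graph `G^d` on `n` vertices (meant for `1 ≤ d` and `d + 2 ≤ n`). With `a = ⌊d / 2⌋`: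
* the vertices `0, …, d` form the path `v_0 v_1 ⋯ v_d`;
* the vertex `d + 1` is `u`, adjacent to `v_a` and `v_{a+1}`;
* the `n - d - 2` vertices `d + 2, …, n - 1` are pendent vertices attached to `v_a`.
`SimpleGraph.fromRel` symmetrizes the relation. -/
def extremalGraph (n d : ℕ) : SimpleGraph (Fin n) :=
  SimpleGraph.fromRel fun i j =>
    ((j : ℕ) = i + 1 ∧ (j : ℕ) ≤ d) ∨
    ((i : ℕ) = d / 2 ∧ (j : ℕ) = d + 1) ∨
    ((i : ℕ) = d / 2 + 1 ∧ (j : ℕ) = d + 1) ∨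
    ((i : ℕ) = d / 2 ∧ d + 2 ≤ (j : ℕ))

/-! Expanding the exponential, `SLEE` is the sum of tr(Q^k)/k!, so one graph beats another as soon
as no trace of a power of Q drops and one of them grows.

The graph operation behind all comparisons is polarization. Let σ be an involution that splits its
moved vertices into positive and negative ones. Every edge between a fixed vertex and a negative
vertex is pushed to the mirror-image positive vertex, unless that edge is already there. In the
basis of sums and differences of exchanged unit vectors, Q(G) becomes a matrix M and Q of the
polarized graph a matrix N with |M x y| ≤ N x y (`IsPartialReflection.abs_conj_le`), so traces of
powers cannot decrease. They increase strictly once a negative entry of M closes up a walk along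
positive entries (`IsPartialReflection.SLEE_lt`).

Two involutions suffice: the reflection p j ↦ p (c - j) of an initial segment of an induced path
(`IsMaxSLEE.reflect_false`), and the exchange of a path vertex with a vertex off the path
(`IsMaxSLEE.kelmans_false`). Polarization keeps the number of edges and, in these cases,
connectedness and the induced path. Hence the maximum is taken over all unicyclic graphs with an
induced path of length d, a class containing those of diameter d.

In a maximal graph these moves, with the count of edges, attach every vertex directly to the path,
produce a triangle on a path edge, and force triangle and pendant vertices to the centre
(`IsMaxSLEE.exists_isStandard`). So every maximizer is isomorphic to G^d; one exists by finiteness,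
and G^d itself has diameter d. -/

/-! ### The Estrada index as a series of traces -/

open Matrix in
theorem Matrix.IsHermitian.trace_pow_eq_sum_eigenvalues {V : Type*} [Fintype V] [DecidableEq V]
    {A : Matrix V V ℝ} (hA : A.IsHermitian) (k : ℕ) :
    (A ^ k).trace = ∑ i, hA.eigenvalues i ^ k := by
  conv_lhs => rw [hA.spectral_theorem, ← map_pow, Unitary.conjStarAlgAut_apply,
    Matrix.trace_mul_cycle, Unitary.coe_star_mul_self, one_mul, Matrix.diagonal_pow,
    Matrix.trace_diagonal]
  simp

open Classical in
theorem hasSum_SLEE {V : Type*} [Fintype V] (G : SimpleGraph V) :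
    HasSum (fun k : ℕ => (signlessLaplacian G ^ k).trace / (k.factorial : ℝ)) (SLEE G) := by
  have h : ∀ k : ℕ, (signlessLaplacian G ^ k).trace / (k.factorial : ℝ) =
      ∑ i, (signlessLaplacian_isHermitian G).eigenvalues i ^ k / (k.factorial : ℝ) := fun k => by
    rw [(signlessLaplacian_isHermitian G).trace_pow_eq_sum_eigenvalues, Finset.sum_div]
  simp only [h]
  refine hasSum_sum fun i _ => ?_
  rw [Real.exp_eq_exp_ℝ]
  exact NormedSpace.expSeries_div_hasSum_exp _

open Classical in
theorem SLEE_lt_of_trace {V : Type*} [Fintype V] {G H : SimpleGraph V}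
    (hle : ∀ k, (signlessLaplacian G ^ k).trace ≤ (signlessLaplacian H ^ k).trace)
    (hlt : ∃ k, (signlessLaplacian G ^ k).trace < (signlessLaplacian H ^ k).trace) :
    SLEE G < SLEE H := by
  obtain ⟨k, hk⟩ := hlt
  exact hasSum_lt (i := k)
    (fun j => div_le_div_of_nonneg_right (hle j) (Nat.cast_nonneg _))
    (div_lt_div_of_pos_right hk (by positivity)) (hasSum_SLEE G) (hasSum_SLEE H)

open Classical in
theorem SLEE_congr {V W : Type*} [Fintype V] [Fintype W] {G : SimpleGraph V} {H : SimpleGraph W}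
    (e : G ≃g H) : SLEE G = SLEE H := by
  have hQ : signlessLaplacian G = (signlessLaplacian H).submatrix e e := by
    ext x y
    simp [signlessLaplacian, SimpleGraph.degMatrix, Matrix.diagonal_apply,
      SimpleGraph.adjMatrix_apply, e.map_adj_iff, SimpleGraph.Iso.degree_eq]
  have hk : ∀ k, (signlessLaplacian G ^ k).trace = (signlessLaplacian H ^ k).trace := fun k => by
    have : signlessLaplacian G ^ k = (signlessLaplacian H ^ k).submatrix e e := by
      rw [hQ]
      induction k with
      | zero => simpa using (Matrix.submatrix_one_equiv e.toEquiv).symm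
      | succ k ih =>
        rw [pow_succ, ih, pow_succ]
        exact Matrix.submatrix_mul_equiv _ _ _ e.toEquiv _
    rw [this]
    exact Equiv.sum_comp e.toEquiv fun x => (signlessLaplacian H ^ k) x x
  have h := hasSum_SLEE G
  simp only [hk] at h
  exact h.unique (hasSum_SLEE H)

/-! ### Entrywise domination and traces of powers -/

theorem Matrix.abs_pow_apply_le {V : Type*} [Fintype V] [DecidableEq V] {M N : Matrix V V ℝ}
    (h : ∀ x y, |M x y| ≤ N x y) (k : ℕ) (x y : V) : |(M ^ k) x y| ≤ (N ^ k) x y := by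
  induction k generalizing x y with
  | zero => by_cases hxy : x = y <;> simp [hxy]
  | succ k ih =>
    rw [pow_succ, pow_succ, Matrix.mul_apply, Matrix.mul_apply]
    refine (Finset.abs_sum_le_sum_abs _ _).trans (Finset.sum_le_sum fun z _ => ?_)
    rw [abs_mul]
    exact mul_le_mul (ih x z) (h z y) (abs_nonneg _) ((abs_nonneg _).trans (ih x z))

theorem Matrix.trace_pow_le_of_abs_le {V : Type*} [Fintype V] [DecidableEq V] {M N : Matrix V V ℝ}
    (h : ∀ x y, |M x y| ≤ N x y) (k : ℕ) : (M ^ k).trace ≤ (N ^ k).trace :=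
  Finset.sum_le_sum fun x _ => (le_abs_self _).trans (Matrix.abs_pow_apply_le h k x x)

/-- Along steps with positive entries of `M`, some power of `M` stays away from the negative of the
corresponding power of the dominating matrix `N`. -/
theorem Matrix.exists_pow_add_pow_pos {V : Type*} [Fintype V] [DecidableEq V] {M N : Matrix V V ℝ}
    (h : ∀ x y, |M x y| ≤ N x y) {x y : V}
    (hr : Relation.ReflTransGen (fun a b => 0 < M a b) x y) :
    ∃ k : ℕ, 0 < (M ^ k) x y + (N ^ k) x y := by
  induction hr using Relation.ReflTransGen.head_induction_on with
  | refl => exact ⟨0, by simp⟩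
  | @head a c hac _ ih =>
    obtain ⟨k, hk⟩ := ih
    refine ⟨k + 1, ?_⟩
    rw [pow_succ', pow_succ', Matrix.mul_apply, Matrix.mul_apply, ← Finset.sum_add_distrib]
    refine Finset.sum_pos' (fun z _ => ?_) ⟨c, Finset.mem_univ c, ?_⟩
    · have h1 : |M a z * (M ^ k) z y| ≤ N a z * (N ^ k) z y := by
        rw [abs_mul]
        exact mul_le_mul (h a z) (Matrix.abs_pow_apply_le h k z y) (abs_nonneg _)
          ((abs_nonneg _).trans (h a z))
      linarith [neg_abs_le (M a z * (M ^ k) z y)]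
    · have h1 : 0 < M a c * ((M ^ k) c y + (N ^ k) c y) := mul_pos hac hk
      have h2 : M a c * (N ^ k) c y ≤ N a c * (N ^ k) c y :=
        mul_le_mul_of_nonneg_right ((le_abs_self _).trans (h a c))
          ((abs_nonneg _).trans (Matrix.abs_pow_apply_le h k c y))
      linarith

/-- A closed walk with exactly one negative step contributes negatively to the trace for M but
nonnegatively for N. Other walks of M may cancel along the way, so the positive part of the walk is
only used to keep `M ^ k` away from `-N ^ k` at its ends, which is enough to make one summand
strictly smaller. -/
theorem Matrix.exists_trace_pow_lt {V : Type*} [Fintype V] [DecidableEq V] {M N : Matrix V V ℝ}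
    (h : ∀ x y, |M x y| ≤ N x y) {x y : V} (hxy : M x y < 0)
    (hr : Relation.ReflTransGen (fun a b => 0 < M a b) y x) :
    ∃ k : ℕ, (M ^ k).trace < (N ^ k).trace := by
  obtain ⟨k, hk⟩ := Matrix.exists_pow_add_pow_pos h hr
  refine ⟨k + 1, Finset.sum_lt_sum (fun z _ => (le_abs_self _).trans
    (Matrix.abs_pow_apply_le h _ z z)) ⟨x, Finset.mem_univ x, ?_⟩⟩
  rw [Matrix.diag_apply, Matrix.diag_apply, pow_succ', pow_succ', Matrix.mul_apply,
    Matrix.mul_apply]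
  refine Finset.sum_lt_sum (fun z _ => ?_) ⟨y, Finset.mem_univ y, ?_⟩
  · refine (le_abs_self _).trans ?_
    rw [abs_mul]
    exact mul_le_mul (h x z) (Matrix.abs_pow_apply_le h k z x) (abs_nonneg _)
      ((abs_nonneg _).trans (h x z))
  · have h1 : 0 < -M x y * ((M ^ k) y x + (N ^ k) y x) := mul_pos (by linarith) hk
    have h2 : -M x y * (N ^ k) y x ≤ N x y * (N ^ k) y x :=
      mul_le_mul_of_nonneg_right ((neg_le_abs _).trans (h x y))
        ((abs_nonneg _).trans (Matrix.abs_pow_apply_le h k y x))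
    linarith

/-! ### Partial reflections and polarization -/

/-- An involution `σ` with a choice `s` of one vertex (the positive one) from each pair of
exchanged vertices, such that `σ` is an automorphism on the moved vertices and edges between
positive and negative vertices join exchanged vertices only. -/
structure IsPartialReflection {V : Type*} (G : SimpleGraph V) (σ : V → V) (s : V → Prop) :
    Prop where
  invol : Function.Involutive σ
  ne_of_pos : ∀ {x}, s x → σ x ≠ x
  pos_iff : ∀ {x}, σ x ≠ x → (s (σ x) ↔ ¬ s x)
  adj_iff : ∀ {x y}, σ x ≠ x → σ y ≠ y → (G.Adj (σ x) (σ y) ↔ G.Adj x y)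
  cross : ∀ {x y}, s x → s y → G.Adj x (σ y) → x = y

open Classical in
/-- Shift the edges between fixed vertices and negative vertices to the positive side. -/
def SimpleGraph.polarize {V : Type*} (G : SimpleGraph V) (σ : V → V) (s : V → Prop) :
    SimpleGraph V where
  Adj x y :=
    if σ x = x then
      if s y then G.Adj x y ∨ G.Adj x (σ y) else G.Adj x y ∧ G.Adj x (σ y)
    else if σ y = y then
      if s x then G.Adj y x ∨ G.Adj y (σ x) else G.Adj y x ∧ G.Adj y (σ x)
    else G.Adj x y
  symm := ⟨fun x y h => by
    by_cases hx : σ x = x <;> by_cases hy : σ y = y <;>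
      simp only [hx, hy, if_true, if_false, or_self, and_self, ite_self] at h ⊢ <;>
      first | exact h | exact h.symm⟩
  loopless := ⟨fun x h => by
    by_cases hx : σ x = x <;> simp [hx] at h⟩

theorem SimpleGraph.connected_of_forall_reachable {V : Type*} {G H : SimpleGraph V}
    (hG : G.Connected) (h : ∀ x y, G.Adj x y → H.Reachable x y) : H.Connected := by
  have := hG.nonempty
  refine ⟨fun x y => ?_⟩
  obtain ⟨p⟩ := hG.preconnected x y
  induction p with
  | nil => exact .rfl
  | cons e _ ih => exact (h _ _ e).trans ih

section Indicator

variable {V W : Type*}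

open Classical in
/-- The adjacency indicator with real values. -/
noncomputable def SimpleGraph.ind (G : SimpleGraph V) (x y : V) : ℝ :=
  if G.Adj x y then 1 else 0

theorem SimpleGraph.ind_of_adj {G : SimpleGraph V} {x y : V} (h : G.Adj x y) : G.ind x y = 1 :=
  if_pos h

theorem SimpleGraph.ind_of_not_adj {G : SimpleGraph V} {x y : V} (h : ¬ G.Adj x y) :
    G.ind x y = 0 :=
  if_neg h

theorem SimpleGraph.ind_congr {G : SimpleGraph V} {H : SimpleGraph W} {x y : V} {u v : W}
    (h : G.Adj x y ↔ H.Adj u v) : G.ind x y = H.ind u v := by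
  by_cases hu : H.Adj u v
  · rw [ind_of_adj hu, ind_of_adj (h.2 hu)]
  · rw [ind_of_not_adj hu, ind_of_not_adj fun h' => hu (h.1 h')]

theorem SimpleGraph.ind_comm (G : SimpleGraph V) (x y : V) : G.ind x y = G.ind y x :=
  ind_congr (G.adj_comm x y)

theorem SimpleGraph.ind_nonneg (G : SimpleGraph V) (x y : V) : 0 ≤ G.ind x y := by
  unfold SimpleGraph.ind
  split_ifs <;> norm_num

open Classical in
theorem SimpleGraph.degree_eq_sum_ind [Fintype V] (G : SimpleGraph V) (x : V) :
    (G.degree x : ℝ) = ∑ y, G.ind x y := by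
  simp [SimpleGraph.ind, Finset.sum_boole, ← SimpleGraph.card_neighborFinset_eq_degree,
    SimpleGraph.neighborFinset_eq_filter]

end Indicator

namespace IsPartialReflection

variable {V : Type*} {G : SimpleGraph V} {σ : V → V} {s : V → Prop}

theorem not_pos_of_fixed (h : IsPartialReflection G σ s) {x : V} (hx : σ x = x) : ¬ s x :=
  fun hs => h.ne_of_pos hs hx

theorem pos_or_exists (h : IsPartialReflection G σ s) (x : V) :
    σ x = x ∨ s x ∨ ∃ y, s y ∧ x = σ y := by
  by_cases hx : σ x = x
  · exact Or.inl hx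
  · by_cases hs : s x
    · exact Or.inr (Or.inl hs)
    · exact Or.inr (Or.inr ⟨σ x, (h.pos_iff hx).2 hs, (h.invol x).symm⟩)

theorem image_ne (h : IsPartialReflection G σ s) {x : V} (hs : s x) : σ (σ x) ≠ σ x := by
  rw [h.invol x]
  exact (h.ne_of_pos hs).symm

theorem not_pos_image (h : IsPartialReflection G σ s) {x : V} (hs : s x) : ¬ s (σ x) :=
  fun h' => (h.pos_iff (h.ne_of_pos hs)).1 h' hs

theorem polarize_adj_of_fixed (_h : IsPartialReflection G σ s) {x y : V} (hx : σ x = x)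
    (hy : σ y = y) : (G.polarize σ s).Adj x y ↔ G.Adj x y := by
  simp [SimpleGraph.polarize, hx, hy]

theorem polarize_adj_of_moved (_h : IsPartialReflection G σ s) {x y : V} (hx : σ x ≠ x)
    (hy : σ y ≠ y) : (G.polarize σ s).Adj x y ↔ G.Adj x y := by
  simp [SimpleGraph.polarize, hx, hy]

theorem polarize_adj_pos (_h : IsPartialReflection G σ s) {x y : V} (hx : σ x = x)
    (hy : s y) : (G.polarize σ s).Adj x y ↔ G.Adj x y ∨ G.Adj x (σ y) := by
  simp [SimpleGraph.polarize, hx, hy]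

theorem polarize_adj_neg (h : IsPartialReflection G σ s) {x y : V} (hx : σ x = x)
    (hy : s y) : (G.polarize σ s).Adj x (σ y) ↔ G.Adj x y ∧ G.Adj x (σ y) := by
  simp [SimpleGraph.polarize, hx, h.not_pos_image hy, h.invol y, and_comm]

/-- Polarization keeps a graph connected as soon as exchanged vertices stay connected. -/
theorem polarize_connected (h : IsPartialReflection G σ s) (hG : G.Connected)
    (hr : ∀ x, s x → (G.polarize σ s).Reachable x (σ x)) : (G.polarize σ s).Connected := by
  have hfix : ∀ x y, σ x = x → G.Adj x y → (G.polarize σ s).Reachable x y := by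
    intro x y hx hxy
    rcases h.pos_or_exists y with hy | hy | ⟨z, hz, rfl⟩
    · exact ((h.polarize_adj_of_fixed hx hy).2 hxy).reachable
    · exact ((h.polarize_adj_pos hx hy).2 (Or.inl hxy)).reachable
    · exact ((h.polarize_adj_pos hx hz).2 (Or.inr hxy)).reachable.trans (hr z hz)
  have hadj : ∀ x y, G.Adj x y → (G.polarize σ s).Reachable x y := by
    intro x y hxy
    by_cases hx : σ x = x
    · exact hfix x y hx hxy
    by_cases hy : σ y = y
    · exact (hfix y x hy hxy.symm).symm
    · exact ((h.polarize_adj_of_moved hx hy).2 hxy).reachable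
  exact SimpleGraph.connected_of_forall_reachable hG hadj

theorem ind_of_fixed (h : IsPartialReflection G σ s) {x y : V} (hx : σ x = x)
    (hy : σ y = y) : (G.polarize σ s).ind x y = G.ind x y :=
  SimpleGraph.ind_congr (h.polarize_adj_of_fixed hx hy)

theorem ind_of_moved (h : IsPartialReflection G σ s) {x y : V} (hx : σ x ≠ x)
    (hy : σ y ≠ y) : (G.polarize σ s).ind x y = G.ind x y :=
  SimpleGraph.ind_congr (h.polarize_adj_of_moved hx hy)

theorem ind_pos (h : IsPartialReflection G σ s) {x y : V} (hx : σ x = x) (hy : s y) :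
    (G.polarize σ s).ind x y = max (G.ind x y) (G.ind x (σ y)) := by
  by_cases h1 : G.Adj x y <;> by_cases h2 : G.Adj x (σ y) <;>
    simp [SimpleGraph.ind, h.polarize_adj_pos hx hy, h1, h2]

theorem ind_neg (h : IsPartialReflection G σ s) {x y : V} (hx : σ x = x) (hy : s y) :
    (G.polarize σ s).ind x (σ y) = min (G.ind x y) (G.ind x (σ y)) := by
  by_cases h1 : G.Adj x y <;> by_cases h2 : G.Adj x (σ y) <;>
    simp [SimpleGraph.ind, h.polarize_adj_neg hx hy, h1, h2]

theorem ind_add (h : IsPartialReflection G σ s) {x y : V} (hx : σ x = x) (hy : s y) :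
    (G.polarize σ s).ind x y + (G.polarize σ s).ind x (σ y) = G.ind x y + G.ind x (σ y) := by
  rw [h.ind_pos hx hy, h.ind_neg hx hy, max_add_min]

theorem abs_ind_sub_le (h : IsPartialReflection G σ s) {x y : V} (hx : σ x = x) (hy : s y) :
    |G.ind x y - G.ind x (σ y)| ≤
      (G.polarize σ s).ind x y - (G.polarize σ s).ind x (σ y) := by
  rw [h.ind_pos hx hy, h.ind_neg hx hy, max_sub_min_eq_abs, abs_sub_comm]

theorem ind_image (h : IsPartialReflection G σ s) {x y : V} (hx : σ x ≠ x) (hy : σ y ≠ y) :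
    G.ind (σ x) (σ y) = G.ind x y :=
  SimpleGraph.ind_congr (h.adj_iff hx hy)

theorem ind_cross (h : IsPartialReflection G σ s) {x y : V} (hx : s x) (hy : s y) (hxy : x ≠ y) :
    G.ind x (σ y) = 0 :=
  SimpleGraph.ind_of_not_adj fun h' => hxy (h.cross hx hy h')

variable [Fintype V]

theorem sum_comp (h : IsPartialReflection G σ s) (f : V → ℝ) : ∑ x, f (σ x) = ∑ x, f x :=
  Equiv.sum_comp h.invol.toPerm f

theorem two_mul_sum_ind (h : IsPartialReflection G σ s) (H : SimpleGraph V) (x : V) :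
    2 * ∑ y, H.ind x y = ∑ y, (H.ind x y + H.ind x (σ y)) := by
  rw [Finset.sum_add_distrib, h.sum_comp fun y => H.ind x y, two_mul]

open Classical in
theorem degree_fixed (h : IsPartialReflection G σ s) {x : V} (hx : σ x = x) :
    ((G.polarize σ s).degree x : ℝ) = G.degree x := by
  have key : ∀ y, (G.polarize σ s).ind x y + (G.polarize σ s).ind x (σ y) =
      G.ind x y + G.ind x (σ y) := by
    intro y
    rcases h.pos_or_exists y with hy | hy | ⟨z, hz, rfl⟩
    · rw [hy, h.ind_of_fixed hx hy]
    · exact h.ind_add hx hy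
    · rw [h.invol z, add_comm, h.ind_add hx hz, add_comm]
  have := h.two_mul_sum_ind (G.polarize σ s) x
  rw [Finset.sum_congr rfl fun y _ => key y, ← h.two_mul_sum_ind] at this
  rw [SimpleGraph.degree_eq_sum_ind, SimpleGraph.degree_eq_sum_ind]
  linarith

open Classical in
theorem degree_add (h : IsPartialReflection G σ s) {x : V} (hx : s x) :
    ((G.polarize σ s).degree x : ℝ) + (G.polarize σ s).degree (σ x) =
      G.degree x + G.degree (σ x) := by
  simp only [SimpleGraph.degree_eq_sum_ind, ← Finset.sum_add_distrib]
  refine Finset.sum_congr rfl fun y _ => ?_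
  by_cases hy : σ y = y
  · rw [SimpleGraph.ind_comm _ x, SimpleGraph.ind_comm _ (σ x), h.ind_add hy hx,
      G.ind_comm x, G.ind_comm (σ x)]
  · rw [h.ind_of_moved (h.ne_of_pos hx) hy, h.ind_of_moved (h.image_ne hx) hy]

open Classical in
-- Pairing each y with its image, the moved neighbours contribute equally to the degrees of x and σ
-- x in both graphs. Only fixed neighbours matter, and there polarization replaces a difference by
-- its absolute value.
theorem abs_degree_sub_le (h : IsPartialReflection G σ s) {x : V} (hx : s x) :
    |(G.degree x : ℝ) - G.degree (σ x)| ≤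
      (G.polarize σ s).degree x - (G.polarize σ s).degree (σ x) := by
  have e : ∀ H : SimpleGraph V, 2 * ((H.degree x : ℝ) - H.degree (σ x)) =
      ∑ y, ((H.ind x y + H.ind x (σ y)) - (H.ind (σ x) y + H.ind (σ x) (σ y))) := by
    intro H
    rw [Finset.sum_sub_distrib, ← h.two_mul_sum_ind, ← h.two_mul_sum_ind,
      SimpleGraph.degree_eq_sum_ind, SimpleGraph.degree_eq_sum_ind, mul_sub]
  have key : |2 * ((G.degree x : ℝ) - G.degree (σ x))| ≤
      2 * (((G.polarize σ s).degree x : ℝ) - (G.polarize σ s).degree (σ x)) := by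
    rw [e, e]
    refine (Finset.abs_sum_le_sum_abs _ _).trans (Finset.sum_le_sum fun y _ => ?_)
    by_cases hy : σ y = y
    · have h1 := h.abs_ind_sub_le hy hx
      rw [hy, SimpleGraph.ind_comm _ x, SimpleGraph.ind_comm _ (σ x), SimpleGraph.ind_comm _ x,
        SimpleGraph.ind_comm _ (σ x), show ∀ a b : ℝ, a + a - (b + b) = 2 * (a - b) from fun a b => by ring,
        show ∀ a b : ℝ, a + a - (b + b) = 2 * (a - b) from fun a b => by ring, abs_mul,
        abs_two]
      linarith
    · have hy' : σ (σ y) ≠ σ y := fun h' => hy (h.invol.injective h')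
      have hx' := h.ne_of_pos hx
      have h2 := h.ind_image hx' hy'
      rw [h.invol y] at h2
      rw [h.ind_of_moved hx' hy, h.ind_of_moved hx' hy', h.ind_of_moved (h.image_ne hx) hy,
        h.ind_of_moved (h.image_ne hx) hy', h.ind_image hx' hy, h2]
      simp [add_comm]
  rw [abs_mul, abs_two] at key
  linarith

open Classical in
theorem sum_degrees (h : IsPartialReflection G σ s) :
    ∑ x, ((G.polarize σ s).degree x : ℝ) = ∑ x, (G.degree x : ℝ) := by
  have key : ∀ x, ((G.polarize σ s).degree x : ℝ) + (G.polarize σ s).degree (σ x) =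
      G.degree x + G.degree (σ x) := by
    intro x
    rcases h.pos_or_exists x with hx | hx | ⟨z, hz, rfl⟩
    · rw [hx, h.degree_fixed hx]
    · exact h.degree_add hx
    · rw [h.invol z, add_comm, h.degree_add hz, add_comm]
  have h1 := Finset.sum_congr rfl fun x (_ : x ∈ Finset.univ) => key x
  rw [Finset.sum_add_distrib, Finset.sum_add_distrib,
    h.sum_comp fun x => ((G.polarize σ s).degree x : ℝ),
    h.sum_comp fun x => (G.degree x : ℝ)] at h1
  linarith

theorem ncard_edgeSet (h : IsPartialReflection G σ s) :
    (G.polarize σ s).edgeSet.ncard = G.edgeSet.ncard := by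
  classical
  have e : ∀ H : SimpleGraph V, 2 * (H.edgeSet.ncard : ℝ) = ∑ x, (H.degree x : ℝ) := by
    intro H
    rw [← H.coe_edgeFinset, Set.ncard_coe_finset]
    exact_mod_cast H.sum_degrees_eq_twice_card_edges.symm
  have := h.sum_degrees
  rw [← e, ← e] at this
  exact_mod_cast mul_left_cancel₀ two_ne_zero this

theorem isUnicyclic (h : IsPartialReflection G σ s) (hG : IsUnicyclic G)
    (hr : ∀ x, s x → (G.polarize σ s).Reachable x (σ x)) : IsUnicyclic (G.polarize σ s) :=
  ⟨h.polarize_connected hG.1 hr, h.ncard_edgeSet.trans hG.2⟩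

end IsPartialReflection

/-! ### The signless Laplacian in the basis of sums and differences -/

namespace IsPartialReflection

variable {V : Type*} {G : SimpleGraph V} {σ : V → V} {s : V → Prop}

open Classical in
/-- Diagonal coefficient of the basis of sums and differences of exchanged vertices. -/
noncomputable def diagCoeff (σ : V → V) (s : V → Prop) (x : V) : ℝ :=
  if σ x = x then 1 else if s x then 1 else -1

open Classical in
/-- Coefficient of the mirror image in the basis of sums and differences. -/
noncomputable def mirrorCoeff (σ : V → V) (x : V) : ℝ :=
  if σ x = x then 0 else 1

open Classical in
/-- Normalization of the inverse base change. -/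
noncomputable def scaleCoeff (σ : V → V) (x : V) : ℝ :=
  if σ x = x then 1 else 1 / 2

open Classical in
/-- The base change matrix: its columns are the fixed unit vectors and the sums and differences of
the unit vectors at exchanged vertices. -/
noncomputable def baseChange (σ : V → V) (s : V → Prop) : Matrix V V ℝ := Matrix.of fun x y =>
  (if x = y then diagCoeff σ s y else 0) + (if x = σ y then mirrorCoeff σ y else 0)

open Classical in
/-- The inverse of `baseChange`. -/
noncomputable def baseChangeInv (σ : V → V) (s : V → Prop) : Matrix V V ℝ := Matrix.of fun x y =>
  scaleCoeff σ x * ((if y = x then diagCoeff σ s x else 0) +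
    (if y = σ x then mirrorCoeff σ x else 0))

/-- The matrix `A` written in the basis of sums and differences. -/
noncomputable def conj (σ : V → V) (s : V → Prop) (A : Matrix V V ℝ) : Matrix V V ℝ := Matrix.of fun x y =>
  scaleCoeff σ x * (diagCoeff σ s x * (diagCoeff σ s y * A x y + mirrorCoeff σ y * A x (σ y)) +
    mirrorCoeff σ x * (diagCoeff σ s y * A (σ x) y + mirrorCoeff σ y * A (σ x) (σ y)))

theorem conj_fixed_fixed {A : Matrix V V ℝ} {x y : V} (hx : σ x = x) (hy : σ y = y) :
    conj σ s A x y = A x y := by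
  simp [conj, scaleCoeff, diagCoeff, mirrorCoeff, hx, hy]

theorem conj_fixed_pos {A : Matrix V V ℝ} {x y : V} (h : IsPartialReflection G σ s)
    (hx : σ x = x) (hy : s y) : conj σ s A x y = A x y + A x (σ y) := by
  simp [conj, scaleCoeff, diagCoeff, mirrorCoeff, hx, hy, h.ne_of_pos hy]

theorem conj_fixed_neg {A : Matrix V V ℝ} {x y : V} (h : IsPartialReflection G σ s)
    (hx : σ x = x) (hy : s y) : conj σ s A x (σ y) = A x y - A x (σ y) := by
  simp [conj, scaleCoeff, diagCoeff, mirrorCoeff, hx, h.not_pos_image hy,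
    h.invol y, (h.ne_of_pos hy).symm]
  ring

theorem conj_pos_fixed {A : Matrix V V ℝ} {x y : V} (h : IsPartialReflection G σ s)
    (hx : s x) (hy : σ y = y) : conj σ s A x y = (A x y + A (σ x) y) / 2 := by
  simp [conj, scaleCoeff, diagCoeff, mirrorCoeff, hx, hy, h.ne_of_pos hx]
  ring

theorem conj_neg_fixed {A : Matrix V V ℝ} {x y : V} (h : IsPartialReflection G σ s)
    (hx : s x) (hy : σ y = y) : conj σ s A (σ x) y = (A x y - A (σ x) y) / 2 := by
  simp [conj, scaleCoeff, diagCoeff, mirrorCoeff, hy, h.not_pos_image hx,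
    h.invol x, (h.ne_of_pos hx).symm]
  ring

theorem conj_pos_pos {A : Matrix V V ℝ} {x y : V} (h : IsPartialReflection G σ s)
    (hx : s x) (hy : s y) :
    conj σ s A x y = (A x y + A x (σ y) + A (σ x) y + A (σ x) (σ y)) / 2 := by
  simp [conj, scaleCoeff, diagCoeff, mirrorCoeff, hx, hy, h.ne_of_pos hx, h.ne_of_pos hy]
  ring

theorem conj_pos_neg {A : Matrix V V ℝ} {x y : V} (h : IsPartialReflection G σ s)
    (hx : s x) (hy : s y) :
    conj σ s A x (σ y) = (A x y - A x (σ y) + A (σ x) y - A (σ x) (σ y)) / 2 := by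
  simp [conj, scaleCoeff, diagCoeff, mirrorCoeff, hx, h.ne_of_pos hx,
    h.not_pos_image hy, h.invol y, (h.ne_of_pos hy).symm]
  ring

theorem conj_neg_pos {A : Matrix V V ℝ} {x y : V} (h : IsPartialReflection G σ s)
    (hx : s x) (hy : s y) :
    conj σ s A (σ x) y = (A x y + A x (σ y) - A (σ x) y - A (σ x) (σ y)) / 2 := by
  simp [conj, scaleCoeff, diagCoeff, mirrorCoeff, hy, h.ne_of_pos hy,
    h.not_pos_image hx, h.invol x, (h.ne_of_pos hx).symm]
  ring

theorem conj_neg_neg {A : Matrix V V ℝ} {x y : V} (h : IsPartialReflection G σ s)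
    (hx : s x) (hy : s y) :
    conj σ s A (σ x) (σ y) = (A x y - A x (σ y) - A (σ x) y + A (σ x) (σ y)) / 2 := by
  simp [conj, scaleCoeff, diagCoeff, mirrorCoeff, h.not_pos_image hy, h.invol y,
    h.not_pos_image hx, h.invol x, (h.ne_of_pos hx).symm, (h.ne_of_pos hy).symm]
  ring

variable [Fintype V]

theorem mul_baseChange (A : Matrix V V ℝ) (x y : V) :
    (A * baseChange σ s) x y = diagCoeff σ s y * A x y + mirrorCoeff σ y * A x (σ y) := by
  classical
  simp only [Matrix.mul_apply, baseChange, Matrix.of_apply, mul_add, mul_ite, mul_zero,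
    Finset.sum_add_distrib, Finset.sum_ite_eq', Finset.mem_univ, if_true]
  ring

theorem baseChangeInv_mul (A : Matrix V V ℝ) (x y : V) :
    (baseChangeInv σ s * A) x y =
      scaleCoeff σ x * (diagCoeff σ s x * A x y + mirrorCoeff σ x * A (σ x) y) := by
  classical
  simp only [Matrix.mul_apply, baseChangeInv, Matrix.of_apply, mul_assoc, ← Finset.mul_sum, add_mul, ite_mul,
    zero_mul, Finset.sum_add_distrib, Finset.sum_ite_eq', Finset.mem_univ, if_true]

theorem conj_eq (A : Matrix V V ℝ) :
    conj σ s A = baseChangeInv σ s * (A * baseChange σ s) := by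
  ext x y
  rw [baseChangeInv_mul, mul_baseChange, mul_baseChange, conj, Matrix.of_apply]

open Classical in
theorem baseChangeInv_mul_baseChange (h : IsPartialReflection G σ s) :
    baseChangeInv σ s * baseChange σ s = 1 := by
  rw [← one_mul (baseChange σ s), ← conj_eq]
  ext x y
  have key : ∀ {x y : V}, s x → s y → x ≠ σ y := fun hx hy he => h.not_pos_image hy (he ▸ hx)
  rcases h.pos_or_exists x with hx | hx | ⟨z, hz, rfl⟩ <;>
    rcases h.pos_or_exists y with hy | hy | ⟨w, hw, rfl⟩
  · rw [conj_fixed_fixed hx hy]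
  · have h1 : x ≠ y := fun he => h.not_pos_of_fixed hx (he ▸ hy)
    have h2 : x ≠ σ y := fun he => h.image_ne hy (he ▸ hx)
    simp [conj_fixed_pos h hx hy, h1, h2]
  · have h1 : x ≠ w := fun he => h.not_pos_of_fixed hx (he ▸ hw)
    have h2 : x ≠ σ w := fun he => h.image_ne hw (he ▸ hx)
    simp [conj_fixed_neg h hx hw, h1, h2]
  · have h1 : x ≠ y := fun he => h.not_pos_of_fixed hy (he ▸ hx)
    have h2 : σ x ≠ y := fun he => h.image_ne hx (he.symm ▸ hy)
    simp [conj_pos_fixed h hx hy, h1, h2]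
  · have h1 := key hx hy
    have h2 := (key hy hx).symm
    rw [conj_pos_pos h hx hy]
    by_cases he : x = y
    · subst he
      simp [h1, h2]
    · simp [h1, h2, h.invol.injective.eq_iff, he]
  · have h1 := key hx hw
    have h2 := (key hw hx).symm
    rw [conj_pos_neg h hx hw]
    by_cases he : x = w
    · subst he
      simp [h1, h2]
    · simp [h1, h2, h.invol.injective.eq_iff, he]
  · have h1 : z ≠ y := fun he => h.not_pos_of_fixed hy (he ▸ hz)
    have h2 : σ z ≠ y := fun he => h.image_ne hz (he.symm ▸ hy)
    simp [conj_neg_fixed h hz hy, h1, h2]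
  · have h1 := key hz hy
    have h2 := (key hy hz).symm
    rw [conj_neg_pos h hz hy]
    by_cases he : z = y
    · subst he
      simp [h1, h2]
    · simp [h1, h2, h.invol.injective.eq_iff, he]
  · have h1 := key hz hw
    have h2 := (key hw hz).symm
    rw [conj_neg_neg h hz hw]
    by_cases he : z = w
    · subst he
      simp [h1, h2]
    · simp [h1, h2, h.invol.injective.eq_iff, he]

open Classical in
theorem trace_conj_pow (h : IsPartialReflection G σ s) (A : Matrix V V ℝ) (k : ℕ) :
    (conj σ s A ^ k).trace = (A ^ k).trace := by
  have h1 := h.baseChangeInv_mul_baseChange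
  have h2 := mul_eq_one_comm.1 h1
  let u : (Matrix V V ℝ)ˣ := ⟨baseChange σ s, baseChangeInv σ s, h2, h1⟩
  have : conj σ s A = (↑u⁻¹ : Matrix V V ℝ) * A * (u : Matrix V V ℝ) := by
    rw [conj_eq, ← mul_assoc]
    rfl
  rw [this, Units.conj_pow', Matrix.trace_units_conj']

open Classical in
theorem _root_.signlessLaplacian_self (G : SimpleGraph V) (x : V) :
    signlessLaplacian G x x = G.degree x := by
  simp [signlessLaplacian, SimpleGraph.degMatrix]

open Classical in
theorem _root_.signlessLaplacian_of_ne (G : SimpleGraph V) {x y : V} (hxy : x ≠ y) :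
    signlessLaplacian G x y = G.ind x y := by
  simp [signlessLaplacian, SimpleGraph.degMatrix, hxy, SimpleGraph.ind]

open Classical in
theorem _root_.SimpleGraph.ind_le_degree (G : SimpleGraph V) (x y : V) :
    G.ind x y ≤ G.degree x := by
  rw [SimpleGraph.degree_eq_sum_ind]
  exact Finset.single_le_sum (fun z _ => G.ind_nonneg x z) (Finset.mem_univ y)

open Classical in
/-- In the basis of sums and differences, polarization dominates the absolute values. -/
theorem abs_conj_le (h : IsPartialReflection G σ s) (x y : V) :
    |conj σ s (signlessLaplacian G) x y| ≤
      conj σ s (signlessLaplacian (G.polarize σ s)) x y := by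
  have key : ∀ {x y : V}, s x → s y → x ≠ σ y := fun hx hy he => h.not_pos_image hy (he ▸ hx)
  have kf : ∀ {x y : V}, σ x = x → s y → x ≠ y ∧ x ≠ σ y := fun hx hy =>
    ⟨fun he => h.not_pos_of_fixed hx (he ▸ hy), fun he => h.image_ne hy (he ▸ hx)⟩
  have hdiag : ∀ z, s z → |((G.degree z : ℝ) - G.ind z (σ z) - G.ind (σ z) z +
        G.degree (σ z)) / 2| ≤
      ((G.polarize σ s).degree z - (G.polarize σ s).ind z (σ z) - (G.polarize σ s).ind (σ z) z +
        (G.polarize σ s).degree (σ z)) / 2 := fun z hz => by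
    have h1 := h.degree_add hz
    have h2 := h.ind_of_moved (h.ne_of_pos hz) (h.image_ne hz)
    have h3 := h.ind_of_moved (h.image_ne hz) (h.ne_of_pos hz)
    rw [abs_of_nonneg]
    · linarith
    · linarith [G.ind_le_degree z (σ z), G.ind_le_degree (σ z) z]
  have hadd : ∀ z, s z → |((G.degree z : ℝ) + G.ind z (σ z) + G.ind (σ z) z +
        G.degree (σ z)) / 2| ≤
      ((G.polarize σ s).degree z + (G.polarize σ s).ind z (σ z) + (G.polarize σ s).ind (σ z) z +
        (G.polarize σ s).degree (σ z)) / 2 := fun z hz => by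
    have h1 := h.degree_add hz
    have h2 := h.ind_of_moved (h.ne_of_pos hz) (h.image_ne hz)
    have h3 := h.ind_of_moved (h.image_ne hz) (h.ne_of_pos hz)
    rw [abs_of_nonneg]
    · linarith
    · linarith [G.ind_nonneg z (σ z), G.ind_nonneg (σ z) z, G.ind_le_degree z (σ z),
        G.ind_le_degree (σ z) z]
  rcases h.pos_or_exists x with hx | hx | ⟨z, hz, rfl⟩ <;>
    rcases h.pos_or_exists y with hy | hy | ⟨w, hw, rfl⟩
  · rw [conj_fixed_fixed hx hy, conj_fixed_fixed hx hy]
    by_cases hxy : x = y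
    · subst hxy
      rw [signlessLaplacian_self, signlessLaplacian_self, h.degree_fixed hx,
        abs_of_nonneg (Nat.cast_nonneg _)]
    · rw [signlessLaplacian_of_ne _ hxy, signlessLaplacian_of_ne _ hxy, h.ind_of_fixed hx hy,
        abs_of_nonneg (G.ind_nonneg _ _)]
  · have h1 := h.ind_add hx hy
    rw [conj_fixed_pos h hx hy, conj_fixed_pos h hx hy]
    simp only [signlessLaplacian_of_ne _ (kf hx hy).1, signlessLaplacian_of_ne _ (kf hx hy).2]
    rw [abs_of_nonneg (add_nonneg (G.ind_nonneg _ _) (G.ind_nonneg _ _)), h1]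
  · have h1 := h.abs_ind_sub_le hx hw
    rw [conj_fixed_neg h hx hw, conj_fixed_neg h hx hw]
    simpa only [signlessLaplacian_of_ne _ (kf hx hw).1, signlessLaplacian_of_ne _ (kf hx hw).2]
      using h1
  · have h1 := h.ind_add hy hx
    rw [conj_pos_fixed h hx hy, conj_pos_fixed h hx hy]
    simp only [signlessLaplacian_of_ne _ (kf hy hx).1.symm,
      signlessLaplacian_of_ne _ (kf hy hx).2.symm, SimpleGraph.ind_comm _ _ y]
    rw [abs_of_nonneg (by linarith [G.ind_nonneg y x, G.ind_nonneg y (σ x)]), h1]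
  · rw [conj_pos_pos h hx hy, conj_pos_pos h hx hy]
    by_cases hxy : x = y
    · subst hxy
      simpa only [signlessLaplacian_self, signlessLaplacian_of_ne _ (key hx hx),
        signlessLaplacian_of_ne _ (key hx hx).symm] using hadd x hx
    · simp only [signlessLaplacian_of_ne _ hxy, signlessLaplacian_of_ne _ (key hx hy),
        signlessLaplacian_of_ne _ (key hy hx).symm,
        signlessLaplacian_of_ne _ (h.invol.injective.ne hxy)]
      rw [h.ind_of_moved (h.ne_of_pos hx) (h.ne_of_pos hy),
        h.ind_of_moved (h.ne_of_pos hx) (h.image_ne hy),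
        h.ind_of_moved (h.image_ne hx) (h.ne_of_pos hy),
        h.ind_of_moved (h.image_ne hx) (h.image_ne hy), abs_of_nonneg]
      have := G.ind_nonneg
      linarith [this x y, this x (σ y), this (σ x) y, this (σ x) (σ y)]
  · rw [conj_pos_neg h hx hw, conj_pos_neg h hx hw]
    by_cases hxy : x = w
    · subst hxy
      -- The entry coupling the sum and the difference of one exchanged pair is half the difference
      -- of their degrees.
      have h1 := h.abs_degree_sub_le hx
      simp only [signlessLaplacian_self, signlessLaplacian_of_ne _ (key hx hx),
        signlessLaplacian_of_ne _ (key hx hx).symm, SimpleGraph.ind_comm _ x (σ x),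
        sub_add_cancel]
      rw [abs_div, abs_two]
      linarith
    · simp only [signlessLaplacian_of_ne _ hxy, signlessLaplacian_of_ne _ (key hx hw),
        signlessLaplacian_of_ne _ (key hw hx).symm,
        signlessLaplacian_of_ne _ (h.invol.injective.ne hxy)]
      rw [h.ind_of_moved (h.ne_of_pos hx) (h.ne_of_pos hw),
        h.ind_of_moved (h.ne_of_pos hx) (h.image_ne hw),
        h.ind_of_moved (h.image_ne hx) (h.ne_of_pos hw),
        h.ind_of_moved (h.image_ne hx) (h.image_ne hw),
        h.ind_image (h.ne_of_pos hx) (h.ne_of_pos hw), h.ind_cross hx hw hxy,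
        G.ind_comm (σ x), h.ind_cross hw hx (Ne.symm hxy)]
      simp
  · have h1 := h.abs_ind_sub_le hy hz
    rw [conj_neg_fixed h hz hy, conj_neg_fixed h hz hy]
    simp only [signlessLaplacian_of_ne _ (kf hy hz).1.symm,
      signlessLaplacian_of_ne _ (kf hy hz).2.symm, SimpleGraph.ind_comm _ _ y]
    rw [abs_div, abs_two]
    linarith
  · rw [conj_neg_pos h hz hy, conj_neg_pos h hz hy]
    by_cases hxy : z = y
    · subst hxy
      have h1 := h.abs_degree_sub_le hz
      simp only [signlessLaplacian_self, signlessLaplacian_of_ne _ (key hz hz),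
        signlessLaplacian_of_ne _ (key hz hz).symm, SimpleGraph.ind_comm _ z (σ z),
        add_sub_cancel_right]
      rw [abs_div, abs_two]
      linarith
    · simp only [signlessLaplacian_of_ne _ hxy, signlessLaplacian_of_ne _ (key hz hy),
        signlessLaplacian_of_ne _ (key hy hz).symm,
        signlessLaplacian_of_ne _ (h.invol.injective.ne hxy)]
      rw [h.ind_of_moved (h.ne_of_pos hz) (h.ne_of_pos hy),
        h.ind_of_moved (h.ne_of_pos hz) (h.image_ne hy),
        h.ind_of_moved (h.image_ne hz) (h.ne_of_pos hy),
        h.ind_of_moved (h.image_ne hz) (h.image_ne hy),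
        h.ind_image (h.ne_of_pos hz) (h.ne_of_pos hy), h.ind_cross hz hy hxy,
        G.ind_comm (σ z), h.ind_cross hy hz (Ne.symm hxy)]
      simp
  · rw [conj_neg_neg h hz hw, conj_neg_neg h hz hw]
    by_cases hxy : z = w
    · subst hxy
      simpa only [signlessLaplacian_self, signlessLaplacian_of_ne _ (key hz hz),
        signlessLaplacian_of_ne _ (key hz hz).symm] using hdiag z hz
    · simp only [signlessLaplacian_of_ne _ hxy, signlessLaplacian_of_ne _ (key hz hw),
        signlessLaplacian_of_ne _ (key hw hz).symm,
        signlessLaplacian_of_ne _ (h.invol.injective.ne hxy)]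
      -- Polarization does not change this entry, so domination needs it to be nonnegative. The
      -- condition `cross` removes the two terms with a minus sign.
      rw [h.ind_of_moved (h.ne_of_pos hz) (h.ne_of_pos hw),
        h.ind_of_moved (h.ne_of_pos hz) (h.image_ne hw),
        h.ind_of_moved (h.image_ne hz) (h.ne_of_pos hw),
        h.ind_of_moved (h.image_ne hz) (h.image_ne hw),
        h.ind_image (h.ne_of_pos hz) (h.ne_of_pos hw), h.ind_cross hz hw hxy,
        G.ind_comm (σ z), h.ind_cross hw hz (Ne.symm hxy), abs_of_nonneg]
      linarith [G.ind_nonneg z w]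

/-- Polarization strictly increases the signless Laplacian Estrada index when an edge is moved from
a negative vertex `σ y` to `y`, while another fixed vertex prefers the positive side at some `z`
that is joined to `y` through positive vertices. -/
theorem SLEE_lt (h : IsPartialReflection G σ s) {v w y z : V} (hv : σ v = v) (hw : σ w = w)
    (hy : s y) (hz : s z) (hvy : ¬ G.Adj v y) (hvy' : G.Adj v (σ y))
    (hwz : G.Adj w z) (hwz' : ¬ G.Adj w (σ z))
    (hyz : Relation.ReflTransGen (fun a b => s a ∧ s b ∧ G.Adj a b) y z) :
    SLEE G < SLEE (G.polarize σ s) := by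
  classical
  have key : ∀ {x y : V}, s x → s y → x ≠ σ y := fun hx hy he => h.not_pos_image hy (he ▸ hx)
  have kf : ∀ {x y : V}, σ x = x → s y → x ≠ y ∧ x ≠ σ y := fun hx hy =>
    ⟨fun he => h.not_pos_of_fixed hx (he ▸ hy), fun he => h.image_ne hy (he ▸ hx)⟩
  set M := conj σ s (signlessLaplacian G) with hM
  have hstep : ∀ a b, s a → s b → G.Adj a b → 0 < M a b ∧ 0 < M (σ a) (σ b) := by
    intro a b ha hb hab
    have hne := hab.ne
    rw [hM, conj_pos_pos h ha hb, conj_neg_neg h ha hb]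
    simp only [signlessLaplacian_of_ne _ hne, signlessLaplacian_of_ne _ (key ha hb),
      signlessLaplacian_of_ne _ (key hb ha).symm,
      signlessLaplacian_of_ne _ (h.invol.injective.ne hne)]
    rw [h.ind_image (h.ne_of_pos ha) (h.ne_of_pos hb), h.ind_cross ha hb hne, G.ind_comm (σ a),
      h.ind_cross hb ha hne.symm, SimpleGraph.ind_of_adj hab]
    norm_num
  have hneg : Relation.ReflTransGen (fun a b => 0 < M a b) (σ y) (σ z) :=
    Relation.ReflTransGen.lift σ (fun a b hab => (hstep a b hab.1 hab.2.1 hab.2.2).2) _ _ hyz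
  have hpos : Relation.ReflTransGen (fun a b => 0 < M a b) z y := by
    refine Relation.ReflTransGen.mono ?_ _ _ (Relation.ReflTransGen.swap _ _ hyz)
    exact fun a b hab => (hstep a b hab.2.1 hab.1 hab.2.2.symm).1
  have h1 : 0 < M (σ z) w := by
    rw [hM, conj_neg_fixed h hz hw, signlessLaplacian_of_ne _ (kf hw hz).1.symm,
      signlessLaplacian_of_ne _ (kf hw hz).2.symm, SimpleGraph.ind_of_adj hwz.symm,
      SimpleGraph.ind_of_not_adj fun h' => hwz' h'.symm]
    norm_num
  have h2 : 0 < M w z := by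
    rw [hM, conj_fixed_pos h hw hz, signlessLaplacian_of_ne _ (kf hw hz).1,
      signlessLaplacian_of_ne _ (kf hw hz).2, SimpleGraph.ind_of_adj hwz,
      SimpleGraph.ind_of_not_adj hwz']
    norm_num
  have h3 : 0 < M y v := by
    rw [hM, conj_pos_fixed h hy hv, signlessLaplacian_of_ne _ (kf hv hy).1.symm,
      signlessLaplacian_of_ne _ (kf hv hy).2.symm, SimpleGraph.ind_of_adj hvy'.symm,
      SimpleGraph.ind_of_not_adj fun h' => hvy h'.symm]
    norm_num
  have h4 : M v (σ y) < 0 := by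
    rw [hM, conj_fixed_neg h hv hy, signlessLaplacian_of_ne _ (kf hv hy).1,
      signlessLaplacian_of_ne _ (kf hv hy).2, SimpleGraph.ind_of_adj hvy',
      SimpleGraph.ind_of_not_adj hvy]
    norm_num
  -- The walk goes from σ y to σ z among differences, crosses over to the sums through the fixed
  -- vertex w, and returns from z to y among sums, then to v. The negative entry from v to σ y
  -- closes it.
  have hwalk : Relation.ReflTransGen (fun a b => 0 < M a b) (σ y) v :=
    (((hneg.tail h1).tail h2).trans hpos).tail h3
  refine SLEE_lt_of_trace (fun k => ?_) ?_
  · rw [← h.trace_conj_pow, ← h.trace_conj_pow (signlessLaplacian (G.polarize σ s))]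
    exact Matrix.trace_pow_le_of_abs_le h.abs_conj_le k
  · obtain ⟨k, hk⟩ := Matrix.exists_trace_pow_lt h.abs_conj_le h4 hwalk
    refine ⟨k, ?_⟩
    rwa [← h.trace_conj_pow, ← h.trace_conj_pow (signlessLaplacian (G.polarize σ s))]

end IsPartialReflection

/-! ### Reflections of segments of an induced path -/

/-- The vertices `p 0, …, p d` form an induced path of `G`. -/
structure IsInducedPath {V : Type*} (G : SimpleGraph V) (d : ℕ) (p : ℕ → V) : Prop where
  inj : ∀ {i j}, i ≤ d → j ≤ d → p i = p j → i = j
  adj : ∀ {i j}, i ≤ d → j ≤ d → (G.Adj (p i) (p j) ↔ i + 1 = j ∨ j + 1 = i)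

/-- The vertex `w` is none of `p 0, …, p d`. -/
def OffPath {V : Type*} (d : ℕ) (p : ℕ → V) (w : V) : Prop :=
  ∀ i ≤ d, w ≠ p i

namespace IsInducedPath

variable {V : Type*} {G : SimpleGraph V} {d : ℕ} {p : ℕ → V}

theorem reverse (hp : IsInducedPath G d p) : IsInducedPath G d fun i => p (d - i) where
  inj := fun {i j} hi hj h => by
    have := hp.inj (Nat.sub_le d i) (Nat.sub_le d j) h
    omega
  adj := fun {i j} hi hj => by
    rw [hp.adj (Nat.sub_le d i) (Nat.sub_le d j)]
    omega

theorem off_reverse {w : V} (hw : OffPath d p w) : OffPath d (fun i => p (d - i)) w :=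
  fun i _ => hw (d - i) (Nat.sub_le d i)

theorem reachable (hp : IsInducedPath G d p) {i j : ℕ} (hi : i ≤ d) (hj : j ≤ d) :
    G.Reachable (p i) (p j) := by
  have h0 : ∀ k, k ≤ d → G.Reachable (p 0) (p k) := by
    intro k
    induction k with
    | zero => exact fun _ => .rfl
    | succ k ih =>
      exact fun hk => (ih (by omega)).trans
        ((hp.adj (by omega) hk).2 (Or.inl rfl)).reachable
  exact (h0 i hi).symm.trans (h0 j hj)

open Classical in
/-- The reflection `p j ↦ p (c - j)` of an initial segment of the path. -/
noncomputable def reflect (p : ℕ → V) (c : ℕ) (x : V) : V :=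
  if h : ∃ j, j ≤ c ∧ x = p j then p (c - h.choose) else x

theorem reflect_apply (hp : IsInducedPath G d p) {c j : ℕ} (hc : c ≤ d) (hj : j ≤ c) :
    reflect p c (p j) = p (c - j) := by
  have h : ∃ i, i ≤ c ∧ p j = p i := ⟨j, hj, rfl⟩
  have := hp.inj (hj.trans hc) (h.choose_spec.1.trans hc) h.choose_spec.2
  rw [reflect, dif_pos h, ← this]

theorem reflect_of_off {c : ℕ} (hc : c ≤ d) {w : V} (hw : OffPath d p w) :
    reflect p c w = w :=
  dif_neg fun ⟨j, hj, h⟩ => hw j (hj.trans hc) h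

theorem reflect_of_lt (hp : IsInducedPath G d p) {c j : ℕ} (hc : c < j) (hj : j ≤ d) :
    reflect p c (p j) = p j :=
  dif_neg fun ⟨i, hi, h⟩ => by
    have := hp.inj hj (by omega) h
    omega

/-- The far half of the reflected segment. -/
def farHalf (p : ℕ → V) (c : ℕ) (x : V) : Prop :=
  ∃ j, j ≤ c ∧ c < 2 * j ∧ x = p j

theorem exists_of_reflect_ne (hp : IsInducedPath G d p) {c : ℕ} (hc : c ≤ d) {x : V}
    (hx : reflect p c x ≠ x) : ∃ j, j ≤ c ∧ 2 * j ≠ c ∧ x = p j := by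
  by_cases h : ∃ j, j ≤ c ∧ x = p j
  · obtain ⟨j, hj, rfl⟩ := h
    refine ⟨j, hj, fun h2 => hx ?_, rfl⟩
    rw [hp.reflect_apply hc hj]
    congr 1
    omega
  · exact absurd (dif_neg h) hx

theorem isPartialReflection (hp : IsInducedPath G d p) {c : ℕ} (hc : c ≤ d) :
    IsPartialReflection G (reflect p c) (farHalf p c) where
  invol := fun x => by
    by_cases h : reflect p c x = x
    · rw [h, h]
    · obtain ⟨j, hj, -, rfl⟩ := hp.exists_of_reflect_ne hc h
      rw [hp.reflect_apply hc hj, hp.reflect_apply hc (Nat.sub_le c j)]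
      congr 1
      omega
  ne_of_pos := by
    rintro _ ⟨j, hj, h2, rfl⟩ h
    rw [hp.reflect_apply hc hj] at h
    have := hp.inj (by omega) (by omega) h
    omega
  pos_iff := fun {x} h => by
    obtain ⟨j, hj, h2, rfl⟩ := hp.exists_of_reflect_ne hc h
    rw [hp.reflect_apply hc hj]
    constructor
    · rintro ⟨i, hi, h3, h4⟩ ⟨k, hk, h5, h6⟩
      have := hp.inj (by omega) (by omega) h4
      have := hp.inj (by omega) (by omega) h6
      omega
    · intro h3
      refine ⟨c - j, Nat.sub_le c j, ?_, rfl⟩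
      by_contra h4
      exact h3 ⟨j, hj, by omega, rfl⟩
  adj_iff := fun {x y} hx hy => by
    obtain ⟨i, hi, h2, rfl⟩ := hp.exists_of_reflect_ne hc hx
    obtain ⟨j, hj, h3, rfl⟩ := hp.exists_of_reflect_ne hc hy
    rw [hp.reflect_apply hc hi, hp.reflect_apply hc hj, hp.adj (by omega) (by omega),
      hp.adj (by omega) (by omega)]
    omega
  cross := by
    rintro _ _ ⟨i, hi, h2, rfl⟩ ⟨j, hj, h3, rfl⟩ h
    -- Here i + j ≥ c + 1 since both indices exceed c / 2, so adjacency across the centre forces i =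
    -- j = (c + 1) / 2.
    rw [hp.reflect_apply hc hj, hp.adj (by omega) (by omega)] at h
    congr 1
    omega

/-- The only path edges between fixed and moved vertices are the one leaving the segment at `p c`,
already on the positive side, and for even c the two at the centre, which mirror each other.
Polarization leaves all of these in place. -/
theorem polarize_reflect (hp : IsInducedPath G d p) {c : ℕ} (hc : c ≤ d) :
    IsInducedPath (G.polarize (reflect p c) (farHalf p c)) d p where
  inj := hp.inj
  adj := fun {i j} hi hj => by
    have hr := hp.isPartialReflection hc
    have hfix : ∀ {i j}, i ≤ d → j ≤ d → reflect p c (p i) = p i →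
        ((G.polarize (reflect p c) (farHalf p c)).Adj (p i) (p j) ↔ G.Adj (p i) (p j)) := by
      intro i j hi hj h
      by_cases h' : reflect p c (p j) = p j
      · exact hr.polarize_adj_of_fixed h h'
      have hi' : c < i ∨ 2 * i = c := by
        by_contra hcon
        rw [hp.reflect_apply hc (by omega)] at h
        have := hp.inj (by omega) hi h
        omega
      have hj' : j ≤ c ∧ 2 * j ≠ c := by
        obtain ⟨k, hk, h2, h3⟩ := hp.exists_of_reflect_ne hc h'
        have := hp.inj hj (by omega) h3
        omega
      by_cases hs : c < 2 * j
      · rw [hr.polarize_adj_pos h ⟨j, hj'.1, hs, rfl⟩, hp.reflect_apply hc hj'.1,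
          hp.adj hi hj, hp.adj hi (by omega)]
        omega
      · have e : p j = reflect p c (p (c - j)) := by
          rw [hp.reflect_apply hc (Nat.sub_le c j)]
          congr 1
          omega
        conv_lhs => rw [e]
        rw [hr.polarize_adj_neg h ⟨c - j, Nat.sub_le c j, by omega, rfl⟩, ← e, hp.adj hi hj,
          hp.adj hi (by omega)]
        omega
    rw [← hp.adj hi hj]
    by_cases h : reflect p c (p i) = p i
    · exact hfix hi hj h
    by_cases h' : reflect p c (p j) = p j
    · rw [SimpleGraph.adj_comm, hfix hj hi h', SimpleGraph.adj_comm]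
    exact hr.polarize_adj_of_moved h h'

theorem reflTransGen_farHalf (hp : IsInducedPath G d p) {c i j : ℕ} (hc : c ≤ d) (hi : i ≤ c)
    (hi' : c < 2 * i) (hj : j ≤ c) (hj' : c < 2 * j) :
    Relation.ReflTransGen (fun a b => farHalf p c a ∧ farHalf p c b ∧ G.Adj a b) (p i) (p j) := by
  have hup : ∀ {i j}, i ≤ j → c < 2 * i → j ≤ c →
      Relation.ReflTransGen (fun a b => farHalf p c a ∧ farHalf p c b ∧ G.Adj a b)
        (p i) (p j) := by
    intro i j hij hi
    induction j, hij using Nat.le_induction with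
    | base => exact fun _ => .refl
    | succ j hij ih =>
      intro hj
      exact (ih (by omega)).tail ⟨⟨j, by omega, by omega, rfl⟩, ⟨j + 1, hj, by omega, rfl⟩,
        (hp.adj (by omega) (by omega)).2 (Or.inl rfl)⟩
  rcases le_total i j with h | h
  · exact hup h hi' hj
  · have : Std.Symm (fun a b => farHalf p c a ∧ farHalf p c b ∧ G.Adj a b) :=
      ⟨fun a b h => ⟨h.2.1, h.1, h.2.2.symm⟩⟩
    exact symm (hup h hj' hi)

end IsInducedPath

/-! ### Moves excluded by maximality -/

/-- The graph `G` has maximum signless Laplacian Estrada index among the unicyclic graphs on its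
vertex set with an induced path of length `d`. -/
def IsMaxSLEE {V : Type*} [Fintype V] (d : ℕ) (G : SimpleGraph V) : Prop :=
  IsUnicyclic G ∧ ∀ H : SimpleGraph V, IsUnicyclic H → (∃ q, IsInducedPath H d q) →
    SLEE H ≤ SLEE G

namespace IsMaxSLEE

variable {V : Type*} [Fintype V] {G : SimpleGraph V} {d : ℕ} {p : ℕ → V}

/-- Polarizing would move the edge at `p i` to the far half. The gain is strict if some fixed vertex
already prefers the far half, which is what the last hypothesis supplies. -/
theorem reflect_false (hM : IsMaxSLEE d G) (hp : IsInducedPath G d p) {c i : ℕ} {w : V}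
    (hc : c ≤ d) (hw : OffPath d p w) (hi : 2 * i < c) (h1 : G.Adj w (p i))
    (h2 : ¬ G.Adj w (p (c - i)))
    (h3 : c < d ∨ ∃ v j, OffPath d p v ∧ j ≤ c ∧ c < 2 * j ∧ G.Adj v (p j) ∧
      ¬ G.Adj v (p (c - j))) : False := by
  have hr := hp.isPartialReflection hc
  have hp' := hp.polarize_reflect hc
  have hU : IsUnicyclic (G.polarize (IsInducedPath.reflect p c) (IsInducedPath.farHalf p c)) := by
    refine hr.isUnicyclic hM.1 ?_
    rintro _ ⟨j, hj, -, rfl⟩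
    rw [hp.reflect_apply hc hj]
    exact hp'.reachable (by omega) (by omega)
  have hle := hM.2 _ hU ⟨p, hp'⟩
  have hsub : c - (c - i) = i := by omega
  suffices h : ∃ v j, IsInducedPath.reflect p c v = v ∧ j ≤ c ∧ c < 2 * j ∧ G.Adj v (p j) ∧
      ¬ G.Adj v (p (c - j)) by
    obtain ⟨v, j, hv, hj, hj', h4, h5⟩ := h
    refine hle.not_gt (hr.SLEE_lt (IsInducedPath.reflect_of_off hc hw) hv
      ⟨c - i, Nat.sub_le c i, by omega, rfl⟩ ⟨j, hj, hj', rfl⟩ h2 ?_ h4 ?_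
      (hp.reflTransGen_farHalf hc (Nat.sub_le c i) (by omega) hj hj'))
    · rwa [hp.reflect_apply hc (Nat.sub_le c i), hsub]
    · rwa [hp.reflect_apply hc hj]
  rcases h3 with h3 | ⟨v, j, hv, hj⟩
  -- When the segment stops before the end of the path, the next path vertex is the fixed vertex
  -- that prefers the far half.
  · refine ⟨p (c + 1), c, hp.reflect_of_lt (by omega) (by omega), le_rfl, by omega,
      (hp.adj (by omega) hc).2 (by omega), fun h => ?_⟩
    have := (hp.adj (by omega) (by omega)).1 h
    omega
  · exact ⟨v, j, IsInducedPath.reflect_of_off hc hv, hj⟩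

/-- This is polarization for the transposition of `p i` and v, with `p i` positive: private
neighbours of v are handed to `p i`. The hypothesis `hP` keeps the path induced, `hlink` keeps v
connected to `p i`, and x and y are private neighbours on either side, making the gain strict. -/
theorem kelmans_false (hM : IsMaxSLEE d G) (hp : IsInducedPath G d p) {i : ℕ} {v x y : V}
    (hi : i ≤ d) (hv : OffPath d p v)
    (hlink : G.Adj (p i) v ∨ ∃ z, G.Adj z (p i) ∧ G.Adj z v)
    (hP : ∀ j ≤ d, G.Adj v (p j) → j = i ∨ G.Adj (p i) (p j))
    (hx : G.Adj x v) (hx' : ¬ G.Adj x (p i)) (hx'' : x ≠ p i)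
    (hy : G.Adj y (p i)) (hy' : ¬ G.Adj y v) (hy'' : y ≠ v) : False := by
  classical
  set u := p i with hu
  have huv : u ≠ v := fun h => hv i hi h.symm
  have hmoved : ∀ {a}, Equiv.swap u v a ≠ a → a = u ∨ a = v := fun {a} h => by
    by_contra hcon
    push Not at hcon
    exact h (Equiv.swap_apply_of_ne_of_ne hcon.1 hcon.2)
  have hr : IsPartialReflection G (Equiv.swap u v) (· = u) :=
    { invol := fun a => Equiv.swap_apply_self u v a
      ne_of_pos := by
        rintro _ rfl
        simpa using huv.symm
      pos_iff := fun {a} ha => by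
        rcases hmoved ha with rfl | rfl
        · simp [huv.symm]
        · simp [huv.symm]
      adj_iff := fun {a b} ha hb => by
        rcases hmoved ha with rfl | rfl <;> rcases hmoved hb with rfl | rfl <;>
          simp [G.adj_comm]
      cross := by
        rintro _ _ rfl rfl _
        rfl }
  have hfix : ∀ {a}, a ≠ u → a ≠ v → Equiv.swap u v a = a :=
    fun h h' => Equiv.swap_apply_of_ne_of_ne h h'
  have hsu : Equiv.swap u v u = v := Equiv.swap_apply_left u v
  have hp' : IsInducedPath (G.polarize (Equiv.swap u v) (· = u)) d p :=
    { inj := hp.inj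
      adj := fun {a b} ha hb => by
        have hedge : ∀ b ≤ d, b ≠ i →
            ((G.polarize (Equiv.swap u v) (· = u)).Adj (p b) u ↔ G.Adj (p b) u) := by
          intro b hb hbi
          rw [hr.polarize_adj_pos (hfix (fun h => hbi (hp.inj hb hi h)) (hv b hb).symm) rfl, hsu]
          exact ⟨fun h => h.elim id fun h' => ((hP b hb h'.symm).resolve_left hbi).symm,
            Or.inl⟩
        rw [← hp.adj ha hb]
        by_cases hai : a = i
        · by_cases hbi : b = i
          · rw [hai, hbi]
            simp
          · rw [hai, ← hu, SimpleGraph.adj_comm, hedge b hb hbi, SimpleGraph.adj_comm]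
        · by_cases hbi : b = i
          · rw [hbi, ← hu, hedge a ha hai]
          · exact hr.polarize_adj_of_fixed
              (hfix (fun h => hai (hp.inj ha hi h)) (hv a ha).symm)
              (hfix (fun h => hbi (hp.inj hb hi h)) (hv b hb).symm) }
  have hU : IsUnicyclic (G.polarize (Equiv.swap u v) (· = u)) := by
    refine hr.isUnicyclic hM.1 ?_
    rintro _ rfl
    rw [hsu]
    rcases hlink with h | ⟨z, h, h'⟩
    · refine ((hr.polarize_adj_of_moved (hr.ne_of_pos rfl) ?_).2 h).reachable
      simpa using huv
    · have hz := hfix h.ne h'.ne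
      have e1 := (hr.polarize_adj_pos hz rfl).2 (Or.inl h)
      have e2 := hr.polarize_adj_neg hz rfl
      rw [hsu] at e2
      exact e1.symm.reachable.trans (e2.2 ⟨h, h'⟩).reachable
  have hle := hM.2 _ hU ⟨p, hp'⟩
  exact hle.not_gt (hr.SLEE_lt (hfix hx'' hx.ne) (hfix hy.ne hy'') rfl rfl hx'
    (by rwa [hsu]) hy (by rwa [hsu]) .refl)

end IsMaxSLEE

/-! ### Consequences of having as many edges as vertices -/

/-- The graph left after the deletion would be connected with two edges fewer than vertices. -/
theorem IsUnicyclic.false_of_deleteEdges {V : Type*} [Fintype V] {G : SimpleGraph V}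
    (hU : IsUnicyclic G) {a b a' b' : V} (h1 : G.Adj a b) (h2 : G.Adj a' b')
    (hne : s(a, b) ≠ s(a', b'))
    (hr : (G.deleteEdges {s(a, b), s(a', b')}).Reachable a b)
    (hr' : (G.deleteEdges {s(a, b), s(a', b')}).Reachable a' b') : False := by
  classical
  have hc : (G.deleteEdges {s(a, b), s(a', b')}).Connected := by
    refine SimpleGraph.connected_of_forall_reachable hU.1 fun x y hxy => ?_
    by_cases hx : s(x, y) = s(a, b)
    · rcases Sym2.eq_iff.1 hx with ⟨rfl, rfl⟩ | ⟨rfl, rfl⟩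
      · exact hr
      · exact hr.symm
    by_cases hx' : s(x, y) = s(a', b')
    · rcases Sym2.eq_iff.1 hx' with ⟨rfl, rfl⟩ | ⟨rfl, rfl⟩
      · exact hr'
      · exact hr'.symm
    exact (SimpleGraph.deleteEdges_adj.2 ⟨hxy, by simp [hx, hx']⟩).reachable
  have hcard := hc.card_vert_le_card_edgeSet_add_one
  have hsub : ({s(a, b), s(a', b')} : Set (Sym2 V)) ⊆ G.edgeSet := by
    rintro e (rfl | rfl)
    · exact h1
    · exact h2
  rw [SimpleGraph.edgeSet_deleteEdges, Nat.card_coe_set_eq, Set.ncard_sdiff hsub,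
    Set.ncard_pair hne, hU.2, Nat.card_eq_fintype_card] at hcard
  have : 2 ≤ Fintype.card V := by
    rw [← hU.2, ← Set.ncard_pair hne]
    exact Set.ncard_le_ncard hsub
  omega

namespace IsInducedPath

variable {V : Type*} {G : SimpleGraph V} {d : ℕ} {p : ℕ → V}

theorem sym2_ne {a x : V} {i j : ℕ} (ha : OffPath d p a) (hi : i ≤ d) (hj : j ≤ d)
    (hx : x ≠ a ∨ i ≠ j) (hp : IsInducedPath G d p) : s(x, p i) ≠ s(a, p j) := by
  intro h
  rcases Sym2.eq_iff.1 h with ⟨rfl, e⟩ | ⟨-, e⟩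
  · exact hx.elim (fun h => h rfl) fun h => h (hp.inj hi hj e)
  · exact ha i hi e.symm

variable [Fintype V]

/-- In a unicyclic graph one cannot remove two edges outside an induced path and keep their ends
attached to the path. -/
theorem false_of_anchored (hp : IsInducedPath G d p) (hU : IsUnicyclic G) {a b a' b' : V}
    (h1 : G.Adj a b) (h2 : G.Adj a' b') (ha : OffPath d p a) (ha' : OffPath d p a')
    (hne : s(a, b) ≠ s(a', b'))
    (hanch : ∀ x, x = a ∨ x = b ∨ x = a' ∨ x = b' → ∃ k ≤ d, x = p k ∨
      G.Adj x (p k) ∧ s(x, p k) ≠ s(a, b) ∧ s(x, p k) ≠ s(a', b')) : False := by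
  have hpath : IsInducedPath (G.deleteEdges {s(a, b), s(a', b')}) d p :=
    { inj := hp.inj
      adj := fun {i j} hi hj => by
        rw [← hp.adj hi hj, SimpleGraph.deleteEdges_adj]
        refine ⟨fun h => h.1, fun h => ⟨h, ?_⟩⟩
        rintro (h' | h') <;> rcases Sym2.eq_iff.1 h' with ⟨e, -⟩ | ⟨-, e⟩
        · exact ha _ hi e.symm
        · exact ha _ hj e.symm
        · exact ha' _ hi e.symm
        · exact ha' _ hj e.symm }
  have hr : ∀ x, x = a ∨ x = b ∨ x = a' ∨ x = b' →
      (G.deleteEdges {s(a, b), s(a', b')}).Reachable x (p 0) := by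
    intro x hx
    obtain ⟨k, hk, rfl | ⟨h, h3, h4⟩⟩ := hanch x hx
    · exact hpath.reachable hk (Nat.zero_le d)
    · exact (SimpleGraph.deleteEdges_adj.2 ⟨h, by simp only [Set.mem_insert_iff,
        Set.mem_singleton_iff, h3, h4, or_self, not_false_eq_true]⟩).reachable.trans
        (hpath.reachable hk (Nat.zero_le d))
  exact hU.false_of_deleteEdges h1 h2 hne ((hr a (by simp)).trans (hr b (by simp)).symm)
    ((hr a' (by simp)).trans (hr b' (by simp)).symm)

theorem no_three_neighbors (hp : IsInducedPath G d p) (hU : IsUnicyclic G) {w : V} {i j k : ℕ}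
    (hw : OffPath d p w) (hi : i ≤ d) (hj : j ≤ d) (hk : k ≤ d) (hij : i ≠ j) (hik : i ≠ k)
    (hjk : j ≠ k) (h1 : G.Adj w (p i)) (h2 : G.Adj w (p j)) (h3 : G.Adj w (p k)) : False := by
  refine hp.false_of_anchored hU h1 h2 hw hw (hp.sym2_ne hw hi hj (Or.inr hij)) ?_
  have hwk : G.Adj w (p k) ∧ s(w, p k) ≠ s(w, p i) ∧ s(w, p k) ≠ s(w, p j) :=
    ⟨h3, hp.sym2_ne hw hk hi (Or.inr hik.symm), hp.sym2_ne hw hk hj (Or.inr hjk.symm)⟩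
  rintro x (rfl | rfl | rfl | rfl)
  exacts [⟨k, hk, Or.inr hwk⟩, ⟨i, hi, Or.inl rfl⟩, ⟨k, hk, Or.inr hwk⟩, ⟨j, hj, Or.inl rfl⟩]

theorem eq_of_two_neighbors (hp : IsInducedPath G d p) (hU : IsUnicyclic G) {w x : V}
    {i j k l : ℕ} (hw : OffPath d p w) (hx : OffPath d p x) (hi : i ≤ d) (hj : j ≤ d)
    (hk : k ≤ d) (hl : l ≤ d) (hij : i ≠ j) (hkl : k ≠ l) (h1 : G.Adj w (p i))
    (h2 : G.Adj w (p j)) (h3 : G.Adj x (p k)) (h4 : G.Adj x (p l)) : x = w := by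
  by_contra hne
  refine hp.false_of_anchored hU h1 h3 hw hx
    (hp.sym2_ne hx hi hk (Or.inl (Ne.symm hne))) ?_
  rintro y (rfl | rfl | rfl | rfl)
  · exact ⟨j, hj, Or.inr ⟨h2, hp.sym2_ne hw hj hi (Or.inr hij.symm),
      hp.sym2_ne hx hj hk (Or.inl (Ne.symm hne))⟩⟩
  · exact ⟨i, hi, Or.inl rfl⟩
  · exact ⟨l, hl, Or.inr ⟨h4, hp.sym2_ne hw hl hi (Or.inl hne),
      hp.sym2_ne hx hl hk (Or.inr hkl.symm)⟩⟩
  · exact ⟨k, hk, Or.inl rfl⟩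

theorem not_adj_off (hp : IsInducedPath G d p) (hU : IsUnicyclic G)
    (hattach : ∀ x, OffPath d p x → ∃ k ≤ d, G.Adj x (p k)) {w x y : V} {i j : ℕ}
    (hw : OffPath d p w) (hi : i ≤ d) (hj : j ≤ d) (hij : i ≠ j) (h1 : G.Adj w (p i))
    (h2 : G.Adj w (p j)) (hx : OffPath d p x) (hy : OffPath d p y) : ¬ G.Adj x y := by
  intro h3
  have hxy : ∀ z k, k ≤ d → s(z, p k) ≠ s(x, y) := by
    intro z k hk h
    rcases Sym2.eq_iff.1 h with ⟨-, e⟩ | ⟨-, e⟩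
    · exact hy k hk e.symm
    · exact hx k hk e.symm
  have hanch : ∀ z, OffPath d p z → ∃ k ≤ d, z = p k ∨
      G.Adj z (p k) ∧ s(z, p k) ≠ s(w, p i) ∧ s(z, p k) ≠ s(x, y) := by
    intro z hz
    by_cases hzw : z = w
    · subst hzw
      exact ⟨j, hj, Or.inr ⟨h2, hp.sym2_ne hw hj hi (Or.inr hij.symm), hxy _ _ hj⟩⟩
    · obtain ⟨k, hk, h⟩ := hattach z hz
      exact ⟨k, hk, Or.inr ⟨h, hp.sym2_ne hw hk hi (Or.inl hzw), hxy _ _ hk⟩⟩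
  refine hp.false_of_anchored hU h1 h3 hw hx (hxy _ _ hi) ?_
  rintro z (rfl | rfl | rfl | rfl)
  exacts [hanch _ hw, ⟨i, hi, Or.inl rfl⟩, hanch _ hx, hanch _ hy]

/-- A unicyclic graph is not a caterpillar over an induced path. -/
theorem exists_extra_edge (hp : IsInducedPath G d p) (hU : IsUnicyclic G)
    (hattach : ∀ x, OffPath d p x → ∃ k ≤ d, G.Adj x (p k)) :
    (∃ w i j, OffPath d p w ∧ i < j ∧ j ≤ d ∧ G.Adj w (p i) ∧ G.Adj w (p j)) ∨
    ∃ x y, OffPath d p x ∧ OffPath d p y ∧ G.Adj x y := by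
  classical
  by_contra hcon
  push Not at hcon
  obtain ⟨hone, hno⟩ := hcon
  -- Rooting the caterpillar at `p 0`, each other vertex is assigned the edge to its parent. These
  -- edges exhaust the graph, which would then have fewer edges than vertices.
  have hparent : ∀ x, ∃ e : Sym2 V, (∀ k ≤ d, OffPath d p x → G.Adj x (p k) → s(x, p k) = e) ∧
      ∀ k < d, x = p (k + 1) → s(p k, p (k + 1)) = e := by
    intro x
    by_cases hx : OffPath d p x
    · obtain ⟨k, hk, h⟩ := hattach x hx
      refine ⟨s(x, p k), fun l hl _ h' => ?_, fun l hl h' => absurd h' (hx _ hl)⟩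
      rcases lt_trichotomy k l with hkl | rfl | hkl
      · exact absurd h' (hone x k l hx hkl hl h)
      · rfl
      · exact absurd h (hone x l k hx hkl hk h')
    · by_cases h : ∃ k, k < d ∧ x = p (k + 1)
      · obtain ⟨k, hk, rfl⟩ := h
        refine ⟨s(p k, p (k + 1)), fun _ _ h' => absurd h' hx, fun l hl h' => ?_⟩
        have : k = l := by
          have := hp.inj (by omega) (by omega) h'
          omega
        rw [this]
      · exact ⟨s(x, x), fun _ _ h' => absurd h' hx, fun k hk h' => absurd ⟨k, hk, h'⟩ h⟩
  choose f hf1 hf2 using hparent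
  have hsub : G.edgeSet ⊆ f '' {p 0}ᶜ := by
    intro e
    induction e with
    | _ x y =>
      intro h
      rw [SimpleGraph.mem_edgeSet] at h
      by_cases hx : OffPath d p x
      · have hy : ¬ OffPath d p y := fun hy => hno x y hx hy h
        unfold OffPath at hy
        push Not at hy
        obtain ⟨k, hk, rfl⟩ := hy
        exact ⟨x, hx 0 (Nat.zero_le d), (hf1 x k hk hx h).symm⟩
      · unfold OffPath at hx
        push Not at hx
        obtain ⟨k, hk, rfl⟩ := hx
        by_cases hy : OffPath d p y
        · refine ⟨y, hy 0 (Nat.zero_le d), ?_⟩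
          rw [← hf1 y k hk hy h.symm, Sym2.eq_swap]
        · unfold OffPath at hy
          push Not at hy
          obtain ⟨l, hl, rfl⟩ := hy
          rcases (hp.adj hk hl).1 h with rfl | rfl
          · refine ⟨p (k + 1), fun h0 => ?_, (hf2 _ k (by omega) rfl).symm⟩
            have := hp.inj hl (by omega) h0
            omega
          · refine ⟨p (l + 1), fun h0 => ?_, ?_⟩
            · have := hp.inj hk (by omega) h0
              omega
            · rw [← hf2 _ l (by omega) rfl, Sym2.eq_swap]
  have h1 := (Set.ncard_le_ncard hsub).trans (Set.ncard_image_le (Set.toFinite _))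
  have h2 := Set.ncard_add_ncard_compl ({p 0} : Set V)
  rw [Set.ncard_singleton, Nat.card_eq_fintype_card] at h2
  rw [hU.2] at h1
  omega

end IsInducedPath

/-! ### Attachment to the path and existence of a triangle -/

namespace IsMaxSLEE

variable {V : Type*} [Fintype V] {G : SimpleGraph V} {d : ℕ} {p : ℕ → V}

/-- Reflecting with c = i + j - 1 moves the edge at `p i` to `p (j - 1)`, next to `p j`. The bound
on i + j makes the segment fit in the path. -/
theorem neighbors_consecutive_aux (hM : IsMaxSLEE d G) (hp : IsInducedPath G d p) {w : V}
    {i j : ℕ} (hw : OffPath d p w) (hij : i + 1 < j) (hj : j ≤ d) (h1 : G.Adj w (p i))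
    (h2 : G.Adj w (p j)) (hc : i + j ≤ d + 1) : False := by
  have h3 : ¬ G.Adj w (p (i + j - 1 - i)) := fun h => hp.no_three_neighbors hM.1 hw
    (by omega : i ≤ d) hj (by omega : i + j - 1 - i ≤ d) (by omega) (by omega) (by omega) h1 h2 h
  refine hM.reflect_false hp (c := i + j - 1) (i := i) (by omega) hw (by omega) h1 h3 ?_
  by_cases hcd : i + j - 1 < d
  · exact Or.inl hcd
  · refine Or.inr ⟨w, j, hw, by omega, by omega, h2, fun h => ?_⟩
    exact hp.no_three_neighbors hM.1 hw (by omega : i ≤ d) hj (by omega : i + j - 1 - j ≤ d)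
      (by omega) (by omega) (by omega) h1 h2 h

/-- In a maximal graph the path neighbours of a vertex off the path are consecutive. -/
theorem neighbors_consecutive (hM : IsMaxSLEE d G) (hp : IsInducedPath G d p) {w : V} {i j : ℕ}
    (hw : OffPath d p w) (hij : i < j) (hj : j ≤ d) (h1 : G.Adj w (p i))
    (h2 : G.Adj w (p j)) : j = i + 1 := by
  by_contra hne
  by_cases hc : i + j ≤ d + 1
  · exact hM.neighbors_consecutive_aux hp hw (by omega) hj h1 h2 hc
  · refine hM.neighbors_consecutive_aux hp.reverse (IsInducedPath.off_reverse hw)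
      (i := d - j) (j := d - i) (by omega) (by omega) ?_ ?_ (by omega)
    · rwa [show d - (d - j) = j by omega]
    · rwa [show d - (d - i) = i by omega]

theorem adj_of_adj_off (hM : IsMaxSLEE d G) (hp : IsInducedPath G d p) {v x : V} {i k : ℕ}
    (hv : OffPath d p v) (hx : OffPath d p x) (hi : i ≤ d) (hvi : G.Adj v (p i))
    (hP : ∀ j ≤ d, G.Adj v (p j) → j = i ∨ G.Adj (p i) (p j)) (hk : k ≤ d)
    (hki : G.Adj (p k) (p i)) (hkv : ¬ G.Adj (p k) v) (hxv : G.Adj x v) : G.Adj x (p i) := by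
  by_contra h
  exact hM.kelmans_false hp hi hv (Or.inl hvi.symm) hP hxv h (hx i hi) hki hkv (hv k hk).symm

theorem adj_of_adj_pendant (hM : IsMaxSLEE d G) (hd : 2 ≤ d) (hp : IsInducedPath G d p)
    {v x : V} {i : ℕ} (hv : OffPath d p v) (hx : OffPath d p x) (hi : i ≤ d)
    (hvi : G.Adj v (p i)) (hP : ∀ j ≤ d, G.Adj v (p j) → j = i) (hxv : G.Adj x v) :
    G.Adj x (p i) := by
  obtain ⟨k, hk, hki⟩ : ∃ k ≤ d, k + 1 = i ∨ i + 1 = k := by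
    by_cases h : i < d
    · exact ⟨i + 1, h, Or.inr rfl⟩
    · exact ⟨i - 1, by omega, by omega⟩
  refine hM.adj_of_adj_off hp hv hx hi hvi (fun j hj h => Or.inl (hP j hj h)) hk
    ((hp.adj hk hi).2 hki) (fun h => ?_) hxv
  have := hP k hk h.symm
  omega

/-- Otherwise some edge leads from an unattached y to an attached v off the path, and handing y over
to a path neighbour of v improves the graph. -/
theorem attached (hM : IsMaxSLEE d G) (hd : 2 ≤ d) (hp : IsInducedPath G d p) (x : V)
    (hx : OffPath d p x) : ∃ k ≤ d, G.Adj x (p k) := by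
  by_contra hcon
  let S : Set V := {x | OffPath d p x ∧ ¬ ∃ k ≤ d, G.Adj x (p k)}
  obtain ⟨q⟩ := hM.1.1.preconnected x (p 0)
  obtain ⟨⟨⟨y, v⟩, hyv⟩, -, hy, hv⟩ := q.exists_boundary_dart S ⟨hx, hcon⟩
    fun h => h.1 0 (Nat.zero_le d) rfl
  simp only at hyv hy hv
  have hoff : OffPath d p v := by
    rintro k hk rfl
    exact hy.2 ⟨k, hk, hyv⟩
  obtain ⟨i, hi, hvi⟩ : ∃ k ≤ d, G.Adj v (p k) := by
    by_contra h
    exact hv ⟨hoff, h⟩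
  by_cases hone : ∀ j ≤ d, G.Adj v (p j) → j = i
  · exact hy.2 ⟨i, hi, hM.adj_of_adj_pendant hd hp hoff hy.1 hi hvi hone hyv⟩
  obtain ⟨m, hm, hm1, hm2⟩ : ∃ m < d, G.Adj v (p m) ∧ G.Adj v (p (m + 1)) := by
    push Not at hone
    obtain ⟨j, hj, hvj, hne⟩ := hone
    rcases lt_or_gt_of_ne hne with h | h
    · have := hM.neighbors_consecutive hp hoff h hi hvj hvi
      subst this
      exact ⟨j, by omega, hvj, hvi⟩
    · have := hM.neighbors_consecutive hp hoff h hj hvi hvj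
      subst this
      exact ⟨i, by omega, hvi, hvj⟩
  have honly : ∀ j ≤ d, G.Adj v (p j) → j = m ∨ j = m + 1 := by
    intro j hj h
    by_contra hne
    exact hp.no_three_neighbors hM.1 hoff hj hm.le (by omega : m + 1 ≤ d) (by omega) (by omega)
      (by omega) h hm1 hm2
  -- The exchange needs a neighbour `p k` of `p i` that v lacks. As d ≥ 2, the edge between `p m`
  -- and `p (m + 1)` is extended by the path on at least one side.
  have main : ∀ i k, (i = m ∨ i = m + 1) → k ≤ d → (k + 1 = i ∨ i + 1 = k) →
      k ≠ m → k ≠ m + 1 → False := by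
    intro i k him hk hki h1 h2
    have hi : i ≤ d := by omega
    have hvi : G.Adj v (p i) := by rcases him with rfl | rfl <;> assumption
    refine hy.2 ⟨i, hi, hM.adj_of_adj_off hp hoff hy.1 hi hvi (fun j hj h => ?_) hk
      ((hp.adj hk hi).2 hki) (fun h => ?_) hyv⟩
    · rw [hp.adj hi hj]
      have := honly j hj h
      omega
    · have := honly k hk h.symm
      omega
  by_cases h0 : m = 0
  · exact main 1 2 (by omega) hd (by omega) (by omega) (by omega)
  · exact main m (m - 1) (by omega) (by omega) (by omega) (by omega) (by omega)

/-- A maximal graph has an induced path of length `d` and a triangle on one of its edges. -/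
theorem exists_triangle (hM : IsMaxSLEE d G) (hd : 2 ≤ d) (hp : IsInducedPath G d p) :
    ∃ q, IsInducedPath G d q ∧ ∃ w i, OffPath d q w ∧ i < d ∧ G.Adj w (q i) ∧
      G.Adj w (q (i + 1)) := by
  by_cases htwo : ∃ w i j, OffPath d p w ∧ i < j ∧ j ≤ d ∧ G.Adj w (p i) ∧ G.Adj w (p j)
  · obtain ⟨w, i, j, hw, hij, hj, h1, h2⟩ := htwo
    have := hM.neighbors_consecutive hp hw hij hj h1 h2
    subst this
    exact ⟨p, hp, w, i, hw, by omega, h1, h2⟩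
  obtain ⟨v, x, hv, hx, hvx⟩ :=
    (hp.exists_extra_edge hM.1 (hM.attached hd hp)).resolve_left htwo
  have hone : ∀ w i j, OffPath d p w → i ≤ d → j ≤ d → G.Adj w (p i) → G.Adj w (p j) →
      j = i := by
    intro w i j hw hi hj h1 h2
    by_contra hne
    rcases lt_or_gt_of_ne hne with h | h
    · exact htwo ⟨w, j, i, hw, h, hi, h2, h1⟩
    · exact htwo ⟨w, i, j, hw, h, hj, h1, h2⟩
  have hshare : ∀ w z i, OffPath d p w → OffPath d p z → i ≤ d → G.Adj w (p i) → G.Adj z w →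
      G.Adj z (p i) := fun w z i hw hz hi h1 h2 =>
    hM.adj_of_adj_pendant hd hp hw hz hi h1 (fun j hj h => hone w i j hw hi hj h1 h) h2
  obtain ⟨i, hi, hvi⟩ := hM.attached hd hp v hv
  have hxi := hshare v x i hv hx hi hvi hvx.symm
  -- Now v, x and `p i` form a triangle. Exchanging x with a path neighbour `p j` of `p i`, linked
  -- to it through `p i`, would transfer v to `p j`; this is a strict gain if `p j` has a neighbour
  -- other than `p i`.
  have main : ∀ j, j ≤ d → (j + 1 = i ∨ i + 1 = j) → ∀ y, G.Adj y (p j) → y = p i := by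
    intro j hj hij y hy
    by_contra hyi
    refine hM.kelmans_false hp hj hx (Or.inr ⟨p i, (hp.adj hi hj).2 (by omega), hxi.symm⟩)
      (fun k hk h => Or.inr ?_) hvx (fun h => ?_) (hv j hj) hy (fun h => ?_) ?_
    · rw [hone x i k hx hi hk hxi h, hp.adj hj hi]
      omega
    · have := hone v i j hv hi hj hvi h
      omega
    · by_cases hyo : OffPath d p y
      · have := hone y i j hyo hi hj (hshare x y i hx hyo hi hxi h) hy
        omega
      · unfold OffPath at hyo
        push Not at hyo
        obtain ⟨k, hk, rfl⟩ := hyo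
        exact hyi (by rw [hone x i k hx hi hk hxi h.symm])
    · rintro rfl
      have := hone _ i j hx hi hj hxi hy
      omega
  have hi1 : i = 1 ∧ d = 2 := by
    by_contra hcon
    by_cases h2 : i + 2 ≤ d
    · have := hp.inj h2 hi (main (i + 1) (by omega) (by omega) (p (i + 2))
        ((hp.adj h2 (by omega)).2 (by omega)))
      omega
    · have := hp.inj (by omega) hi (main (i - 1) (by omega) (by omega) (p (i - 2))
        ((hp.adj (by omega) (by omega)).2 (by omega)))
      omega
  obtain ⟨rfl, rfl⟩ := hi1
  have h0x : ¬ G.Adj (p 0) x := fun h => by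
    have := hone x 1 0 hx hi (by omega) hxi h.symm
    omega
  have h0x' : ¬ G.Adj x (p 0) := fun h => h0x h.symm
  have h01 : G.Adj (p 0) (p 1) := (hp.adj (by omega) hi).2 (by omega)
  have hne : p 0 ≠ p 1 := h01.ne
  have hx0 := hx 0 (by omega)
  have hx1 := hx 1 (by omega)
  -- In the remaining case d = 2, i = 1 the path is rerouted through x, and v forms a triangle on
  -- its second edge.
  refine ⟨fun k => if k = 0 then p 0 else if k = 1 then p 1 else x, ⟨?_, ?_⟩, v, 1, ?_, by omega,
    by simpa using hvi, by simpa using hvx⟩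
  · intro a b ha hb h
    revert h
    interval_cases a <;> interval_cases b <;> simp [hne, hne.symm, hx0, hx0.symm, hx1, hx1.symm]
  · intro a b ha hb
    interval_cases a <;> interval_cases b <;>
      simp [h0x, h01, h01.symm, hxi, hxi.symm, h0x']
  · intro k hk
    have hv0 := hv 0 (by omega)
    have hv1 := hv 1 (by omega)
    interval_cases k <;> simp [hv0, hv1, hvx.ne]

end IsMaxSLEE

/-! ### Locating the triangle and the pendant vertices -/

/-- The graph `G` consists of the induced path `p 0, …, p d`, a vertex `w` forming a triangle with
`p (d / 2)` and `p (d / 2 + 1)`, and pendant vertices at `p (d / 2)`. -/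
structure IsStandard {V : Type*} (G : SimpleGraph V) (d : ℕ) (p : ℕ → V) (w : V) : Prop where
  path : IsInducedPath G d p
  off : OffPath d p w
  adj_iff : ∀ {k}, k ≤ d → (G.Adj w (p k) ↔ k = d / 2 ∨ k = d / 2 + 1)
  pendant_iff : ∀ {x k}, OffPath d p x → x ≠ w → k ≤ d → (G.Adj x (p k) ↔ k = d / 2)
  not_adj : ∀ {x y}, OffPath d p x → OffPath d p y → ¬ G.Adj x y

namespace IsMaxSLEE

variable {V : Type*} [Fintype V] {G : SimpleGraph V} {d : ℕ} {p : ℕ → V}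

/-- Otherwise the reflection with c = d - 1 pushes the edge at `p i` towards the centre. Applied to
the reversed path as well, this pins the triangle to the middle. -/
theorem triangle_position (hM : IsMaxSLEE d G) (hp : IsInducedPath G d p) {w : V} {i : ℕ}
    (hw : OffPath d p w) (hi : i < d) (h1 : G.Adj w (p i)) (h2 : G.Adj w (p (i + 1))) :
    d ≤ 2 * i + 2 := by
  by_contra hcon
  refine hM.reflect_false hp (c := d - 1) (by omega) hw (i := i) (by omega) h1 (fun h => ?_)
    (Or.inl (by omega))
  exact hp.no_three_neighbors hM.1 hw hi.le (by omega : i + 1 ≤ d) (by omega : d - 1 - i ≤ d)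
    (by omega) (by omega) (by omega) h1 h2 h

theorem pendant_position (hM : IsMaxSLEE d G) (hp : IsInducedPath G d p) {w x : V} {i j : ℕ}
    (hw : OffPath d p w) (hi : i < d) (h1 : G.Adj w (p i)) (h2 : G.Adj w (p (i + 1)))
    (hx : OffPath d p x) (hxw : x ≠ w) (hj : j ≤ d) (h3 : G.Adj x (p j)) : d ≤ 2 * j + 1 := by
  by_contra hcon
  refine hM.reflect_false hp (c := d - 1) (by omega) hx (i := j) (by omega) h3 (fun h => ?_)
    (Or.inl (by omega))
  exact hxw (hp.eq_of_two_neighbors hM.1 hw hx hi.le (by omega : i + 1 ≤ d) hj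
    (by omega : d - 1 - j ≤ d) (by omega) (by omega) h1 h2 h3 h)

theorem isStandard_of (hM : IsMaxSLEE d G) (hd : 2 ≤ d) (hp : IsInducedPath G d p) {w : V}
    (hw : OffPath d p w) (h1 : G.Adj w (p (d / 2))) (h2 : G.Adj w (p (d / 2 + 1)))
    (hall : ∀ x, OffPath d p x → x ≠ w → G.Adj x (p (d / 2))) : IsStandard G d p w where
  path := hp
  off := hw
  adj_iff := fun {k} hk => by
    constructor
    · intro h
      by_contra hne
      exact hp.no_three_neighbors hM.1 hw hk (by omega : d / 2 ≤ d) (by omega : d / 2 + 1 ≤ d)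
        (by omega) (by omega) (by omega) h h1 h2
    · rintro (rfl | rfl) <;> assumption
  pendant_iff := fun {x k} hx hxw hk => by
    constructor
    · intro h
      by_contra hne
      exact hxw (hp.eq_of_two_neighbors hM.1 hw hx (by omega : d / 2 ≤ d)
        (by omega : d / 2 + 1 ≤ d) hk (by omega : d / 2 ≤ d) (by omega) hne h1 h2 h
        (hall x hx hxw))
    · rintro rfl
      exact hall x hx hxw
  not_adj := fun {x y} hx hy =>
    hp.not_adj_off hM.1 (hM.attached hd hp) hw (by omega : d / 2 ≤ d) (by omega : d / 2 + 1 ≤ d)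
      (by omega) h1 h2 hx hy

/-- For even d the pendant vertices sit at the centre and the triangle on one of the two central
edges. For odd d the triangle sits on the central edge, and the pendant vertices must agree on one
of its ends. Reversing the path settles the remaining choice. -/
theorem exists_isStandard (hM : IsMaxSLEE d G) (hd : 2 ≤ d) (hex : ∃ p, IsInducedPath G d p) :
    ∃ p w, IsStandard G d p w := by
  obtain ⟨p₀, hp₀⟩ := hex
  obtain ⟨p, hp, w, i, hw, hi, h1, h2⟩ := hM.exists_triangle hd hp₀
  have hq := hp.reverse
  have hwq := IsInducedPath.off_reverse hw
  have h2' : G.Adj w (p (d - (d - 1 - i))) := by rwa [show d - (d - 1 - i) = i + 1 by omega]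
  have h1'' : G.Adj w (p (d - (d - 1 - i + 1))) := by
    rwa [show d - (d - 1 - i + 1) = i by omega]
  have ht := hM.triangle_position hp hw hi h1 h2
  have ht' := hM.triangle_position hq hwq (i := d - 1 - i) (by omega) h2' h1''
  have hpend : ∀ x, OffPath d p x → x ≠ w →
      ∃ j ≤ d, G.Adj x (p j) ∧ d ≤ 2 * j + 1 ∧ 2 * j ≤ d + 1 := by
    intro x hx hxw
    obtain ⟨j, hj, h⟩ := hM.attached hd hp x hx
    refine ⟨j, hj, h, hM.pendant_position hp hw hi h1 h2 hx hxw hj h, ?_⟩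
    have := hM.pendant_position hq hwq (i := d - 1 - i) (by omega) h2' h1''
      (IsInducedPath.off_reverse hx) hxw (Nat.sub_le d j)
      (by rwa [show d - (d - j) = j by omega])
    omega
  have hrev : d / 2 = d - 1 - i → (∀ x, OffPath d p x → x ≠ w → G.Adj x (p (d - d / 2))) →
      ∃ p w, IsStandard G d p w := by
    intro hi' h
    refine ⟨_, w, hM.isStandard_of hd hq hwq ?_ ?_ fun x hx hxw => h x (fun k hk => ?_) hxw⟩
    · rwa [hi']
    · rwa [hi']
    · have := hx (d - k) (Nat.sub_le d k)
      simpa only [show d - (d - k) = k by omega] using this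
  by_cases heven : d % 2 = 0
  · have hpend' : ∀ x, OffPath d p x → x ≠ w → G.Adj x (p (d / 2)) := by
      intro x hx hxw
      obtain ⟨j, hj, h, h3, h4⟩ := hpend x hx hxw
      rwa [show d / 2 = j by omega]
    by_cases hi' : i = d / 2
    · exact ⟨p, w, hM.isStandard_of hd hp hw (hi' ▸ h1) (hi' ▸ h2) hpend'⟩
    · refine hrev (by omega) fun x hx hxw => ?_
      rw [show d - d / 2 = d / 2 by omega]
      exact hpend' x hx hxw
  have hi' : i = d / 2 := by omega
  by_cases hall : ∀ x, OffPath d p x → x ≠ w → G.Adj x (p (d / 2))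
  · exact ⟨p, w, hM.isStandard_of hd hp hw (hi' ▸ h1) (hi' ▸ h2) hall⟩
  push Not at hall
  obtain ⟨x, hx, hxw, hxa⟩ := hall
  obtain ⟨j, hj, hxj, h3, h4⟩ := hpend x hx hxw
  have hj' : j = d / 2 + 1 := by
    rcases (by omega : j = d / 2 ∨ j = d / 2 + 1) with rfl | h
    · exact absurd hxj hxa
    · exact h
  refine hrev (by omega) fun y hy hyw => ?_
  by_contra hcon
  obtain ⟨k, hk, hyk, h5, h6⟩ := hpend y hy hyw
  have hk' : k = d / 2 := by
    rcases (by omega : k = d / 2 ∨ k = d - d / 2) with h | rfl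
    · exact h
    · exact absurd hyk hcon
  subst hk'
  -- With pendant vertices at both ends of the central edge, reflecting the whole path gathers them
  -- at one end; x, already there, makes the gain strict.
  refine hM.reflect_false hp le_rfl hy (by omega) hyk hcon
    (Or.inr ⟨x, j, hx, hj, by omega, hxj, ?_⟩)
  rwa [show d - j = d / 2 by omega]

end IsMaxSLEE

/-! ### Identification with the extremal graph -/

theorem extremalGraph_adj {n d : ℕ} {i j : Fin n} : (extremalGraph n d).Adj i j ↔
    (i : ℕ) ≠ j ∧
    ((((j : ℕ) = i + 1 ∧ (j : ℕ) ≤ d) ∨ ((i : ℕ) = d / 2 ∧ (j : ℕ) = d + 1) ∨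
      ((i : ℕ) = d / 2 + 1 ∧ (j : ℕ) = d + 1) ∨ ((i : ℕ) = d / 2 ∧ d + 2 ≤ (j : ℕ))) ∨
    (((i : ℕ) = j + 1 ∧ (i : ℕ) ≤ d) ∨ ((j : ℕ) = d / 2 ∧ (i : ℕ) = d + 1) ∨
      ((j : ℕ) = d / 2 + 1 ∧ (i : ℕ) = d + 1) ∨ ((j : ℕ) = d / 2 ∧ d + 2 ≤ (i : ℕ)))) := by
  rw [extremalGraph, SimpleGraph.fromRel_adj, Ne, Fin.ext_iff]

/-- Only the labels up to d + 1 are prescribed. Any bijective extension works because the remaining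
vertices are interchangeable. -/
theorem IsStandard.nonempty_iso {V : Type*} [Fintype V] {G : SimpleGraph V} {n d : ℕ} {p : ℕ → V}
    {w : V} (h : IsStandard G d p w) (hd : 2 ≤ d) (hn : d + 2 ≤ n) (hV : Fintype.card V = n) :
    Nonempty (G ≃g extremalGraph n d) := by
  classical
  have hinj : Set.InjOn (fun j : Fin n => if (j : ℕ) ≤ d then p j else w)
      {j : Fin n | (j : ℕ) ≤ d + 1} := by
    intro i hi j hj hij
    simp only [Set.mem_ofPred_eq] at hi hj
    apply Fin.ext
    by_cases h1 : (i : ℕ) ≤ d <;> by_cases h2 : (j : ℕ) ≤ d <;> simp only [h1, h2, if_true,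
      if_false] at hij
    · exact h.path.inj h1 h2 hij
    · exact absurd hij.symm (h.off _ h1)
    · exact absurd hij (h.off _ h2)
    · omega
  obtain ⟨g, hg⟩ := Set.MapsTo.exists_equiv_extend_of_card_eq (t := (Finset.univ : Finset V))
    (by rw [Finset.card_univ, hV, Fintype.card_fin]) (fun _ _ => Finset.mem_coe.2
      (Finset.mem_univ _)) hinj
  let e : Fin n ≃ V := g.trans (Equiv.subtypeUnivEquiv fun x => Finset.mem_univ x)
  have hpath : ∀ j : Fin n, (j : ℕ) ≤ d → e j = p j := fun j hj => by
    have := hg j (by simp only [Set.mem_ofPred_eq]; omega)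
    rwa [if_pos hj] at this
  have hapex : ∀ j : Fin n, (j : ℕ) = d + 1 → e j = w := fun j hj => by
    have := hg j (by simp only [Set.mem_ofPred_eq]; omega)
    rwa [if_neg (by omega)] at this
  have hoff : ∀ j : Fin n, d < (j : ℕ) → OffPath d p (e j) := fun j hj k hk hjk => by
    have := hpath ⟨k, by omega⟩ hk
    rw [← hjk] at this
    have := congrArg Fin.val (e.injective this)
    simp only at this
    omega
  have hpend : ∀ j : Fin n, d + 1 < (j : ℕ) → e j ≠ w := fun j hj hjw => by
    have := hapex ⟨d + 1, by omega⟩ rfl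
    rw [← hjw] at this
    have := congrArg Fin.val (e.injective this)
    simp only at this
    omega
  have hmix : ∀ i j : Fin n, (i : ℕ) ≤ d → d < (j : ℕ) →
      (G.Adj (e j) (e i) ↔ (extremalGraph n d).Adj j i) := by
    intro i j hi hj
    rw [extremalGraph_adj, hpath i hi]
    by_cases hj' : (j : ℕ) = d + 1
    · rw [hapex j hj', h.adj_iff hi]
      omega
    · rw [h.pendant_iff (hoff j hj) (hpend j (by omega)) hi]
      omega
  refine ⟨SimpleGraph.Iso.symm ⟨e, fun {i j} => ?_⟩⟩
  rcases le_or_gt (i : ℕ) d with hi | hi <;> rcases le_or_gt (j : ℕ) d with hj | hj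
  · rw [extremalGraph_adj, hpath i hi, hpath j hj, h.path.adj hi hj]
    omega
  · rw [G.adj_comm, (extremalGraph n d).adj_comm, hmix i j hi hj]
  · exact hmix j i hj hi
  · refine iff_of_false (h.not_adj (hoff i hi) (hoff j hj)) fun h' => ?_
    rw [extremalGraph_adj] at h'
    omega

/-! ### The extremal graph is unicyclic of diameter d -/

section ExtremalGraph

variable {n d : ℕ}

/-- A neighbour with smaller index for each vertex of the extremal graph other than `0`. -/
def extremalParent (d j : ℕ) : ℕ :=
  if j ≤ d then j - 1 else d / 2

theorem extremalParent_lt (d : ℕ) {j : ℕ} (hj : 0 < j) : extremalParent d j < j := by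
  unfold extremalParent
  split_ifs <;> omega

theorem extremalGraph_adj_parent {j k : Fin n} (hj : 0 < (j : ℕ))
    (hk : (k : ℕ) = extremalParent d j) : (extremalGraph n d).Adj j k := by
  rw [extremalGraph_adj]
  unfold extremalParent at hk
  split_ifs at hk <;> omega

theorem extremalGraph_connected (hd : 2 ≤ d) (hn : d + 2 ≤ n) :
    (extremalGraph n d).Connected := by
  have h0 : ∀ (m : ℕ) (hm : m < n),
      (extremalGraph n d).Reachable ⟨m, hm⟩ ⟨0, by omega⟩ := by
    intro m
    induction m using Nat.strong_induction_on with
    | _ m ih =>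
      intro hm
      rcases Nat.eq_zero_or_pos m with rfl | hpos
      · exact .rfl
      · have hlt := extremalParent_lt d hpos
        exact (extremalGraph_adj_parent (k := ⟨extremalParent d m, hlt.trans hm⟩)
          hpos rfl).reachable.trans (ih _ hlt (hlt.trans hm))
  have : Nonempty (Fin n) := ⟨⟨0, by omega⟩⟩
  exact ⟨fun x y => (h0 x x.2).trans (h0 y y.2).symm⟩

theorem ncard_edgeSet_extremalGraph (hd : 2 ≤ d) (hn : d + 2 ≤ n) :
    (extremalGraph n d).edgeSet.ncard = n := by
  -- Each nonzero vertex is sent to its parent edge; the vertex 0, having none, is sent to the one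
  -- edge outside this spanning tree.
  let f : Fin n → Sym2 (Fin n) := fun j =>
    if h : 0 < (j : ℕ) then s(j, ⟨extremalParent d j, (extremalParent_lt d h).trans j.2⟩)
    else s(⟨d + 1, by omega⟩, ⟨d / 2 + 1, by omega⟩)
  have hinj : Function.Injective f := by
    intro i j hij
    simp only [f] at hij
    apply Fin.ext
    split_ifs at hij with hi hj hj
    · have h1 := extremalParent_lt d hi
      have h2 := extremalParent_lt d hj
      simp only [Sym2.eq_iff, Fin.ext_iff] at hij
      omega
    · have h1 := extremalParent_lt d hi
      simp only [Sym2.eq_iff, Fin.ext_iff] at hij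
      unfold extremalParent at *
      split_ifs at * <;> omega
    · have h1 := extremalParent_lt d hj
      simp only [Sym2.eq_iff, Fin.ext_iff] at hij
      unfold extremalParent at *
      split_ifs at * <;> omega
    · omega
  have hrange : (extremalGraph n d).edgeSet = Set.range f := by
    ext e
    induction e with
    | _ x y =>
      rw [SimpleGraph.mem_edgeSet, Set.mem_range]
      constructor
      · intro h
        by_cases hspecial : ((x : ℕ) = d + 1 ∧ (y : ℕ) = d / 2 + 1) ∨
            ((y : ℕ) = d + 1 ∧ (x : ℕ) = d / 2 + 1)
        · refine ⟨⟨0, by omega⟩, ?_⟩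
          simp only [f, lt_irrefl, dif_neg, not_false_eq_true, Sym2.eq_iff, Fin.ext_iff]
          omega
        rw [extremalGraph_adj] at h
        have key : ((0 : ℕ) < x ∧ (y : ℕ) = extremalParent d x) ∨
            ((0 : ℕ) < y ∧ (x : ℕ) = extremalParent d y) := by
          unfold extremalParent
          split_ifs <;> omega
        rcases key with ⟨hx, hy⟩ | ⟨hy, hx⟩
        · refine ⟨x, ?_⟩
          rw [show f x = _ from dif_pos hx, Sym2.eq_iff]
          exact Or.inl ⟨rfl, Fin.ext hy.symm⟩
        · refine ⟨y, ?_⟩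
          rw [show f y = _ from dif_pos hy, Sym2.eq_iff]
          exact Or.inr ⟨rfl, Fin.ext hx.symm⟩
      · rintro ⟨j, hj⟩
        rw [← SimpleGraph.mem_edgeSet, ← hj]
        simp only [f]
        split_ifs with h
        · exact extremalGraph_adj_parent h rfl
        · rw [SimpleGraph.mem_edgeSet, extremalGraph_adj]
          dsimp only
          omega
  rw [hrange, ← Set.image_univ, Set.ncard_image_of_injective _ hinj, Set.ncard_univ,
    Nat.card_fin]

theorem dist_path_extremalGraph (hd : 2 ≤ d) (hn : d + 2 ≤ n) {i j : Fin n} (hij : i ≤ j)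
    (hj : (j : ℕ) ≤ d) : (extremalGraph n d).dist i j ≤ j - i := by
  have hc := extremalGraph_connected hd hn
  have key : ∀ (m : ℕ) (hm : (i : ℕ) + m < n), (i : ℕ) + m ≤ d →
      (extremalGraph n d).dist i ⟨i + m, hm⟩ ≤ m := by
    intro m
    induction m with
    | zero => simp
    | succ m ih =>
      intro hm hmd
      have hadj : (extremalGraph n d).Adj ⟨i + m, by omega⟩ ⟨i + (m + 1), hm⟩ := by
        rw [extremalGraph_adj]
        simp only
        omega
      have h1 := SimpleGraph.dist_eq_one_iff_adj.2 hadj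
      have h2 := hc.dist_triangle (u := i) (v := ⟨i + m, by omega⟩) (w := ⟨i + (m + 1), hm⟩)
      have h3 := ih (by omega) (by omega)
      omega
  have := key (j - i) (by omega) (by omega)
  have e : (⟨i + (j - i), by omega⟩ : Fin n) = j := Fin.ext (by simp only; omega)
  rwa [e] at this

theorem diam_extremalGraph (hd : 2 ≤ d) (hn : d + 2 ≤ n) : (extremalGraph n d).diam = d := by
  have hc := extremalGraph_connected hd hn
  have : Nonempty (Fin n) := hc.nonempty
  apply le_antisymm
  · obtain ⟨u, v, huv⟩ := (extremalGraph n d).exists_dist_eq_diam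
    rw [← huv]
    -- The spare 1 pays for the step to a vertex off the path, which is adjacent to the centre.
    have hcenter : ∀ x : Fin n, (x : ℕ) ≤ d →
        (extremalGraph n d).dist x ⟨d / 2, by omega⟩ + 1 ≤ d := by
      intro x hx
      rcases le_total x ⟨d / 2, by omega⟩ with h | h
      · have := dist_path_extremalGraph hd hn h (by simp only; omega)
        simp only at this
        omega
      · have := dist_path_extremalGraph hd hn h hx
        rw [SimpleGraph.dist_comm] at this
        simp only at this
        rw [Fin.le_def] at h
        simp only at h
        omega
    have hout : ∀ x : Fin n, d < (x : ℕ) →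
        (extremalGraph n d).dist x ⟨d / 2, by omega⟩ = 1 := by
      intro x hx
      rw [SimpleGraph.dist_eq_one_iff_adj, extremalGraph_adj]
      dsimp only
      omega
    have htri := hc.dist_triangle (u := u) (v := ⟨d / 2, by omega⟩) (w := v)
    rw [SimpleGraph.dist_comm (u := ⟨d / 2, by omega⟩) (v := v)] at htri
    rcases le_or_gt (u : ℕ) d with hu | hu <;> rcases le_or_gt (v : ℕ) d with hv | hv
    · rcases le_total u v with h | h
      · have := dist_path_extremalGraph hd hn h hv
        omega
      · have := dist_path_extremalGraph hd hn h hu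
        rw [SimpleGraph.dist_comm] at this
        omega
    · have := hcenter u hu
      have := hout v hv
      omega
    · have := hout u hu
      have := hcenter v hv
      omega
    · have := hout u hu
      have := hout v hv
      omega
  -- A potential that rises by at most 1 along an edge, with values 0 and d at the ends of the path,
  -- so these ends are at distance at least d.
  · let φ : Fin n → ℕ := fun x =>
      if (x : ℕ) ≤ d then x else if (x : ℕ) = d + 1 then d / 2 + 1 else d / 2
    have hφ : ∀ {x y} (q : (extremalGraph n d).Walk x y), φ y ≤ φ x + q.length := by
      intro x y q
      induction q with
      | nil => simp
      | @cons x z y hxz q ih =>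
        have : φ z ≤ φ x + 1 := by
          rw [extremalGraph_adj] at hxz
          simp only [φ]
          split_ifs <;> omega
        rw [SimpleGraph.Walk.length_cons]
        omega
    obtain ⟨q, hq⟩ := hc.exists_walk_length_eq_dist ⟨0, by omega⟩ ⟨d, by omega⟩
    have h1 := hφ q
    have h2 := SimpleGraph.dist_le_diam (SimpleGraph.connected_iff_ediam_ne_top.1 hc)
      (u := ⟨0, by omega⟩) (v := ⟨d, by omega⟩)
    simp only [φ, le_refl, if_true, Nat.zero_le] at h1
    omega

end ExtremalGraph

/-! ### Geodesics and the conclusion -/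

/-- A shortest walk between two vertices runs along an induced path. -/
theorem SimpleGraph.Connected.exists_isInducedPath {V : Type*} {G : SimpleGraph V}
    (hG : G.Connected) {u v : V} : ∃ p, IsInducedPath G (G.dist u v) p := by
  obtain ⟨q, hq⟩ := hG.exists_walk_length_eq_dist u v
  have hlow : ∀ {i j}, i ≤ j → j ≤ G.dist u v →
      j - i ≤ G.dist (q.getVert i) (q.getVert j) := by
    intro i j hij hj
    have h1 := hG.dist_triangle (u := u) (v := q.getVert i) (w := v)
    have h2 := hG.dist_triangle (u := q.getVert i) (v := q.getVert j) (w := v)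
    have h3 := SimpleGraph.dist_le (q.take i)
    have h4 := SimpleGraph.dist_le (q.drop j)
    rw [SimpleGraph.Walk.take_length] at h3
    rw [SimpleGraph.Walk.drop_length] at h4
    omega
  refine ⟨q.getVert, fun {i j} hi hj h => ?_, fun {i j} hi hj => ⟨fun h => ?_, ?_⟩⟩
  · rcases le_total i j with hij | hij
    · have := hlow hij hj
      rw [h, SimpleGraph.dist_self] at this
      omega
    · have := hlow hij hi
      rw [h, SimpleGraph.dist_self] at this
      omega
  · have hne : i ≠ j := by
      rintro rfl
      exact h.ne rfl
    have h1 := SimpleGraph.dist_eq_one_iff_adj.2 h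
    rcases le_total i j with hij | hij
    · have := hlow hij hj
      omega
    · have := hlow hij hi
      rw [SimpleGraph.dist_comm] at this
      omega
  · rintro (rfl | rfl)
    · exact q.adj_getVert_succ (by omega)
    · exact (q.adj_getVert_succ (by omega)).symm

theorem mainTheorem3 (n d : ℕ) (hd : 2 ≤ d) (hn : d + 2 ≤ n) :
    (IsUnicyclic (extremalGraph n d) ∧ (extremalGraph n d).diam = d) ∧
    ∀ (V : Type*) [Fintype V] (G : SimpleGraph V),
      Fintype.card V = n → IsUnicyclic G → G.diam = d →
        SLEE G ≤ SLEE (extremalGraph n d) ∧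
        (SLEE G = SLEE (extremalGraph n d) ↔ Nonempty (G ≃g extremalGraph n d)) := by
  refine ⟨⟨⟨extremalGraph_connected hd hn, ?_⟩, diam_extremalGraph hd hn⟩,
    fun V _ G hV hG hdiam => ?_⟩
  · rw [ncard_edgeSet_extremalGraph hd hn, Fintype.card_fin]
  have hmem : ∃ p, IsInducedPath G d p := by
    have := hG.1.nonempty
    obtain ⟨u, v, huv⟩ := G.exists_dist_eq_diam
    rw [← hdiam, ← huv]
    exact hG.1.exists_isInducedPath
  have hiso : ∀ H : SimpleGraph V, IsMaxSLEE d H → (∃ p, IsInducedPath H d p) →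
      Nonempty (H ≃g extremalGraph n d) := by
    intro H hM hp
    obtain ⟨p, w, h⟩ := hM.exists_isStandard hd hp
    exact h.nonempty_iso hd hn hV
  -- The maximum is taken over the class closed under the moves, whose members need not have
  -- diameter d; G belongs to it through a geodesic.
  obtain ⟨M, ⟨hMU, hMp⟩, hMmax⟩ := Set.exists_max_image
    {H : SimpleGraph V | IsUnicyclic H ∧ ∃ p, IsInducedPath H d p} SLEE (Set.toFinite _)
    ⟨G, hG, hmem⟩
  have hM : IsMaxSLEE d M := ⟨hMU, fun H hH hq => hMmax H ⟨hH, hq⟩⟩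
  obtain ⟨e⟩ := hiso M hM hMp
  have hSLEE := SLEE_congr e
  refine ⟨hSLEE ▸ hM.2 G hG hmem, fun h => ?_, fun ⟨e'⟩ => SLEE_congr e'⟩
  -- Equality makes G itself maximal, so the classification of maximizers applies to it.
  refine hiso G ⟨hG, fun H hH hq => ?_⟩ hmem
  rw [h, ← hSLEE]
  exact hM.2 H hH hq
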